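/- Setup. Let $R>0$, let $P_*=\mathcal N(R,1)$ be the data distribution and $Q=\mathcal N(0,1)$ the noise distribution, with densities $p_*$ and $q$. For $\tau=(b,c)\in\mathbb R^2$ (with the Euclidean norm) let $T(x)=(x,-1)$ and let $p_\tau(x)=e^{-x^2/2}\,e^{\langle\tau,T(x)\rangle}=e^{-x^2/2+bx-c}$ be the unnormalised model. For $\theta\in\mathbb R$ put $\tau_\theta=(\theta,\ \theta^2/2+\log\sqrt{2\pi})$, so that $p_{\tau_\theta}$ is the density of $\mathcal N(\theta,1)$; write $\tau_*=\tau_R$ and $\tau_q=(0,\log\sqrt{2\pi})$ for the parameters of $P_*$ and $Q$. The NCE loss is $$L(\tau)=\tfrac12\,\mathbb E_{P_*}\log\frac{p_\tau+q}{p_\tau}+\tfrac12\,\mathbb E_{Q}\log\frac{p_\tau+q}{q}.$$ For a bounded set $\Theta\subset\mathbb R$ with $0,R\in\Theta$ let $$\lambda_\rho=\inf_{\theta\in\Theta}\sigma_{\min}(\nabla^2L(\tau_\theta)),\qquad \lambda_M=\sup_{\theta\in\Theta}\sigma_{\max}(\nabla^2L(\tau_\theta))$$ (a minimum and a maximum when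 $\Theta$ is compact), where $\sigma_{\min},\sigma_{\max}$ are the smallest and largest singular values. The damped Newton method with step size $\eta>0$ started at $\tau_q$ is $$\tau^{(0)}=\tau_q,\qquad \tau^{(t+1)}=N_\eta(\tau^{(t)}),\qquad N_\eta(\tau)=\tau-\eta\,(\nabla^2L(\tau))^{-1}\nabla L(\tau).$$ Let $\mathcal A=\{\tau:\ 0.1R\le\|\tau-\tau_*\|\le0.2R\}$. Theorem. For every $C>0$ there are constants $c,K,R_0>0$, depending only on $C$, such that for every $R\ge R_0$ the Hessian $\nabla^2L(\tau)$ is invertible at every $\tau\in\mathbb R^2$ (so the iteration is well defined), and for every bounded $\Theta\subset\mathbb R$ with $0,R\in\Theta$ and every $\eta$ with $0<\eta\le C\,\lambda_\rho/\lambda_M$: 1. every Newton step from a point of the annulus shrinks the distance to $\tau_*$ by only an exponentially small amount: for all $\tau\in\mathcal A$, $$\|\tau-\tau_*\|-\|N_\eta(\tau)-\tau_*\|\ \le\ K\,R^{-3}\exp(-R^2/8);$$ 2. exponentially many steps are needed to get through the annulus: if $\|\tau^{(t)}-\tau_*\|\le0.1R$, then $t\ge c\,R^3\exp(R^2/8)$.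 In particular, since $0.1R\to\infty$, for $R$ large at least this many steps are needed to come within any fixed distance of $\tau_*$. -/

import Mathlib

open Real Set MeasureTheory ProbabilityTheory

noncomputable section

namespace GaussianNCE

/-- The space of extended parameters `τ = (b, c)`: `b` is the natural parameter and `c` is the
estimated log normalising constant. It carries the Euclidean norm. -/
abbrev Param : Type := EuclideanSpace ℝ (Fin 2)

/-- The sufficient statistic `T(x) = (x, -1)`. -/
def suffStat (x : ℝ) : Param := !₂[x, -1]

/-- The (unnormalised) model `p_τ(x) = exp(-x² / 2) * exp ⟨τ, T(x)⟩ = exp(-x² / 2 + b x - c)`. -/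
def model (τ : Param) (x : ℝ) : ℝ :=
  Real.exp (-x ^ 2 / 2) * Real.exp (inner ℝ τ (suffStat x))

/-- The parameter `τ_θ = (θ, θ² / 2 + log √(2π))` of the normalised distribution `N(θ, 1)`. -/
def natParam (θ : ℝ) : Param := !₂[θ, θ ^ 2 / 2 + Real.log (√(2 * π))]

/-- The model at `τ_θ` is the density of `N(θ, 1)`. -/
theorem model_natParam (θ x : ℝ) : model (natParam θ) x = gaussianPDFReal θ 1 x := by
  have h : (0 : ℝ) < √(2 * π) := Real.sqrt_pos.mpr (by positivity)
  have e : (√(2 * π))⁻¹ = Real.exp (-Real.log (√(2 * π))) := by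
    rw [Real.exp_neg, Real.exp_log h]
  simp only [model, natParam, suffStat, gaussianPDFReal, NNReal.coe_one, mul_one]
  rw [e, ← Real.exp_add, ← Real.exp_add]
  congr 1
  simp [PiLp.inner_apply, Fin.sum_univ_two]
  ring

/-- The population NCE loss with data distribution `P_* = N(θstar, 1)` and noise distribution
`Q = N(θq, 1)`:
`L(τ) = 1/2 E_{P_*} log ((p_τ + q) / p_τ) + 1/2 E_Q log ((p_τ + q) / q)`. -/
def loss (θstar θq : ℝ) (τ : Param) : ℝ :=
  1 / 2 * ∫ x, Real.log ((model τ x + gaussianPDFReal θq 1 x) / model τ x)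
      ∂(gaussianReal θstar 1)
    + 1 / 2 * ∫ x, Real.log ((model τ x + gaussianPDFReal θq 1 x) / gaussianPDFReal θq 1 x)
      ∂(gaussianReal θq 1)

/-- The Hessian `∇²L(τ)` of the NCE loss, as an operator on the parameter space. -/
def hessian (θstar θq : ℝ) (τ : Param) : Param →L[ℝ] Param :=
  fderiv ℝ (gradient (loss θstar θq)) τ

/-- The largest singular value of an operator on the (two-dimensional) parameter space. -/
def sigmaMax (A : Param →L[ℝ] Param) : ℝ := (A : Param →ₗ[ℝ] Param).singularValues 0

/-- The smallest singular value of an operator on the (two-dimensional) parameter space. -/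
def sigmaMin (A : Param →L[ℝ] Param) : ℝ := (A : Param →ₗ[ℝ] Param).singularValues 1

/-- `λ_ρ`: the minimum (infimum) over `θ ∈ Θ` of the smallest singular value of `∇²L(τ_θ)`. -/
def lambdaRho (θstar θq : ℝ) (Θ : Set ℝ) : ℝ :=
  sInf ((fun θ => sigmaMin (hessian θstar θq (natParam θ))) '' Θ)

/-- `λ_M`: the maximum (supremum) over `θ ∈ Θ` of the largest singular value of `∇²L(τ_θ)`. -/
def lambdaM (θstar θq : ℝ) (Θ : Set ℝ) : ℝ :=
  sSup ((fun θ => sigmaMax (hessian θstar θq (natParam θ))) '' Θ)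

/-- One damped Newton step with step size `η`: `τ ↦ τ - η (∇²L(τ))⁻¹ ∇L(τ)`. -/
def newtonStep (θstar θq η : ℝ) (τ : Param) : Param :=
  τ - η • (hessian θstar θq τ).inverse (gradient (loss θstar θq) τ)

/-- The `t`-th iterate of the damped Newton method started at `τ_q`. -/
def newtonIter (θstar θq η : ℝ) (t : ℕ) : Param :=
  (newtonStep θstar θq η)^[t] (natParam θq)

/-- The annulus of inner radius `R / 10` and outer radius `R / 5` around `τ_*`, where
`R = |θstar - θq|`. -/
def annulus (θstar θq : ℝ) : Set Param :=
  {τ | ‖τ - natParam θstar‖ ∈ Set.Icc (0.1 * |θstar - θq|) (0.2 * |θstar - θq|)}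

end GaussianNCE

end

/-! With `u = logit`, affine in `x`, the loss averages `log (1 + exp (-u))` under `P_*` and `log (1
+ exp u)` under `Q`. Hence the Hessian is half the integral of `T Tᵀ` against the positive weight
`σ(u) σ(-u) (p_* + q)`, and it is positive definite.

The step size is tiny. At the optimum the weight equals `p_* q / (p_* + q)`, of size `exp (-R² / 8)`
and concentrated near `x = R / 2`, so the Hessian nearly annihilates `axis R`; at the noise
parameter it is at least `R² / 8` in the direction `(1, 0)`. Evaluating the infimum and the supremum
at these two points gives `η = O(exp (-R² / 8) / R⁵)` (`stepSize_le`).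

The Newton direction is only polynomially large. In the annulus `u = b (x - x₀)` with `x₀` well
inside `(0, R)`; gradient and Hessian are both governed by the density `p_* + q` at `x₀`, which
cancels. If `d` is the direction, `⟪d, H d⟫ = ⟪d, ∇L⟫` bounds a quadratic form in `d` by a linear
one, so `‖d‖ = O(R²)` (`norm_newton_direction_le`). Multiplying by `η` gives the first claim.

The second claim does not need the annulus bound. The reflection `x ↦ R - x` swaps `P_*` and `Q`, so
the iterates stay on the line `τ_q + b • axis R` (`newtonStep_axis`). For `0 ≤ b ≤ R` a step
increases `b` by at most `η * axisConst * R` (`neg_inner_axis_gradient_le`), a bound valid from `b =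
0` on. Entering the inner disc requires `b ≥ R / 2`, which forces `t` to be of order at least `1 /
η`. -/

open scoped RealInnerProductSpace

namespace GaussianNCE

/-! ### Singular values as extremal stretching factors. -/

section SingularValues

variable {E : Type*} [NormedAddCommGroup E] [InnerProductSpace ℝ E] [FiniteDimensional ℝ E]

/-- Expand `⟪A† A v, v⟫` in an orthonormal eigenbasis of `A† A`, whose eigenvalues are the squared
singular values. The three bounds that follow all come from this identity. -/
theorem sum_singularValues_sq_mul (A : E →ₗ[ℝ] E) {n : ℕ} (hn : Module.finrank ℝ E = n) (v : E) :
    ‖A v‖ ^ 2 = ∑ i : Fin n, A.singularValues i ^ 2 *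
      ⟪A.isSymmetric_adjoint_comp_self.eigenvectorBasis hn i, v⟫ ^ 2 := by
  have hS := A.isSymmetric_adjoint_comp_self
  have h1 : ‖A v‖ ^ 2 = ⟪(A.adjoint ∘ₗ A) v, v⟫ := by
    rw [LinearMap.comp_apply, LinearMap.adjoint_inner_left, real_inner_self_eq_norm_sq]
  rw [h1, ← (hS.eigenvectorBasis hn).sum_inner_mul_inner]
  refine Finset.sum_congr rfl fun i _ => ?_
  rw [hS v, hS.apply_eigenvectorBasis, A.sq_singularValues_fin hn i, inner_smul_right,
    real_inner_comm v]
  simp only [RCLike.ofReal_real_eq_id, id_eq]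
  ring

theorem norm_apply_le_singularValues_zero (A : E →ₗ[ℝ] E) (v : E) :
    ‖A v‖ ≤ A.singularValues 0 * ‖v‖ := by
  have h0 := A.singularValues_nonneg 0
  refine le_of_sq_le_sq ?_ (by positivity)
  rw [mul_pow, sum_singularValues_sq_mul A rfl v,
    ← (A.isSymmetric_adjoint_comp_self.eigenvectorBasis rfl).sum_sq_inner_right v, Finset.mul_sum]
  refine Finset.sum_le_sum fun i _ => ?_
  gcongr
  · exact A.singularValues_nonneg _
  · exact A.singularValues_antitone (Nat.zero_le _)

theorem singularValues_last_mul_norm_le (A : E →ₗ[ℝ] E) {n : ℕ}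
    (hn : Module.finrank ℝ E = n + 1) (v : E) :
    A.singularValues n * ‖v‖ ≤ ‖A v‖ := by
  have h0 := A.singularValues_nonneg n
  refine le_of_sq_le_sq ?_ (by positivity)
  rw [mul_pow, sum_singularValues_sq_mul A hn v,
    ← (A.isSymmetric_adjoint_comp_self.eigenvectorBasis hn).sum_sq_inner_right v, Finset.mul_sum]
  refine Finset.sum_le_sum fun i _ => ?_
  gcongr
  exact A.singularValues_antitone (Nat.lt_succ_iff.mp i.2)

theorem singularValues_le_of_norm_le (A : E →ₗ[ℝ] E) {K : ℝ} (hK : 0 ≤ K)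
    (h : ∀ v, ‖A v‖ ≤ K * ‖v‖) (i : ℕ) : A.singularValues i ≤ K := by
  by_cases hi : i < Module.finrank ℝ E
  · set e := A.isSymmetric_adjoint_comp_self.eigenvectorBasis rfl with he
    have h1 := sum_singularValues_sq_mul A rfl (e ⟨i, hi⟩)
    rw [← he] at h1
    simp only [OrthonormalBasis.inner_eq_ite] at h1
    simp at h1
    have h2 := h (e ⟨i, hi⟩)
    simp only [OrthonormalBasis.norm_eq_one, mul_one] at h2
    exact le_of_sq_le_sq (h1 ▸ pow_le_pow_left₀ (norm_nonneg _) h2 2) hK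
  · rw [A.singularValues_of_finrank_le (not_lt.mp hi)]
    exact hK

end SingularValues

/-! ### Gaussian moments of the sufficient statistic. -/

theorem norm_suffStat_sq (x : ℝ) : ‖suffStat x‖ ^ 2 = x ^ 2 + 1 := by
  simp [suffStat, EuclideanSpace.norm_sq_eq, Fin.sum_univ_two]

theorem inner_suffStat (d : Param) (x : ℝ) : ⟪d, suffStat x⟫ = d 0 * x - d 1 := by
  simp [suffStat, PiLp.inner_apply, Fin.sum_univ_two]
  ring

theorem continuous_suffStat : Continuous suffStat := by
  unfold suffStat
  refine (PiLp.continuous_toLp 2 _).comp (continuous_pi fun i => ?_)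
  fin_cases i
  · exact continuous_id
  · exact continuous_const

theorem integrable_sq_gaussianReal (θ : ℝ) :
    Integrable (fun x : ℝ => x ^ 2) (gaussianReal θ 1) :=
  (memLp_id_gaussianReal (μ := θ) (v := 1) 2).integrable_sq

theorem integrable_norm_suffStat_sq (θ : ℝ) :
    Integrable (fun x => ‖suffStat x‖ ^ 2) (gaussianReal θ 1) := by
  simp_rw [norm_suffStat_sq]
  exact (integrable_sq_gaussianReal θ).add (integrable_const 1)

theorem integrable_norm_suffStat (θ : ℝ) :
    Integrable (fun x => ‖suffStat x‖) (gaussianReal θ 1) := by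
  refine (integrable_norm_suffStat_sq θ).mono' continuous_suffStat.norm.aestronglyMeasurable ?_
  refine .of_forall fun x => ?_
  rw [norm_norm]
  nlinarith [norm_suffStat_sq x, norm_nonneg (suffStat x), sq_nonneg x]

/-! ### Differentiation under the Gaussian integral. -/

section IntegralCalculus

variable {ψ ψ' : ℝ → ℝ} {K : ℝ}

theorem integrable_bounded_smul_suffStat (hc : Continuous ψ') (hb : ∀ u, |ψ' u| ≤ K)
    (τ : Param) (θ : ℝ) :
    Integrable (fun x => ψ' ⟪τ, suffStat x⟫ • suffStat x) (gaussianReal θ 1) := by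
  refine ((integrable_norm_suffStat θ).const_mul K).mono' ?_ (.of_forall fun x => ?_)
  · exact ((hc.comp (continuous_const.inner continuous_suffStat)).smul
      continuous_suffStat).aestronglyMeasurable
  · rw [norm_smul, norm_eq_abs]
    exact mul_le_mul_of_nonneg_right (hb _) (norm_nonneg _)

/-- The rank-one operator `T(x) T(x)ᵀ`. -/
noncomputable def outerStat (x : ℝ) : Param →L[ℝ] Param :=
  (innerSL ℝ (suffStat x)).smulRight (suffStat x)

theorem outerStat_apply (x : ℝ) (d : Param) :
    outerStat x d = ⟪d, suffStat x⟫ • suffStat x := by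
  simp [outerStat, real_inner_comm]

theorem continuous_outerStat : Continuous outerStat := by
  unfold outerStat
  have := continuous_suffStat
  fun_prop

theorem norm_outerStat_le (x : ℝ) : ‖outerStat x‖ ≤ ‖suffStat x‖ ^ 2 := by
  rw [outerStat, ContinuousLinearMap.norm_smulRight_apply, innerSL_apply_norm, sq]

theorem integrable_bounded_smul_outerStat (hc : Continuous ψ') (hb : ∀ u, |ψ' u| ≤ K)
    (τ : Param) (θ : ℝ) :
    Integrable (fun x => ψ' ⟪τ, suffStat x⟫ • outerStat x) (gaussianReal θ 1) := by
  refine ((integrable_norm_suffStat_sq θ).const_mul K).mono' ?_ (.of_forall fun x => ?_)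
  · exact ((hc.comp (continuous_const.inner continuous_suffStat)).smul
      continuous_outerStat).aestronglyMeasurable
  · rw [norm_smul, norm_eq_abs]
    exact mul_le_mul (hb _) (norm_outerStat_le x) (norm_nonneg _) ((abs_nonneg _).trans (hb 0))

theorem integrable_comp_inner_suffStat (hψ : ∀ u, HasDerivAt ψ (ψ' u) u) (hb : ∀ u, |ψ' u| ≤ K)
    (τ : Param) (θ : ℝ) :
    Integrable (fun x => ψ ⟪τ, suffStat x⟫) (gaussianReal θ 1) := by
  have hcont : Continuous ψ := continuous_iff_continuousAt.2 fun u => (hψ u).continuousAt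
  refine ((integrable_const |ψ 0|).add
    (((integrable_norm_suffStat θ).const_mul ‖τ‖).const_mul K)).mono' ?_ (.of_forall fun x => ?_)
  · exact (hcont.comp (continuous_const.inner continuous_suffStat)).aestronglyMeasurable
  · set u := ⟪τ, suffStat x⟫
    have h1 : ‖ψ u - ψ 0‖ ≤ K * ‖u - 0‖ :=
      convex_univ.norm_image_sub_le_of_norm_hasDerivWithin_le
        (fun y _ => (hψ y).hasDerivWithinAt) (fun y _ => hb y) (mem_univ _) (mem_univ _)
    have h2 : ‖u‖ ≤ ‖τ‖ * ‖suffStat x‖ := norm_inner_le_norm _ _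
    have hK : 0 ≤ K := (abs_nonneg _).trans (hb 0)
    have h3 := norm_sub_norm_le (ψ u) (ψ 0)
    rw [sub_zero] at h1
    have h4 := mul_le_mul_of_nonneg_left h2 hK
    simp only [Pi.add_apply, norm_eq_abs] at *
    linarith

/-- Since `ψ'` is bounded, the derivative of the integrand is dominated by a multiple of `‖T(x)‖`,
uniformly in `τ`; no localisation is needed. The second derivative is treated likewise, with
`‖T(x)‖²`. -/
theorem hasGradientAt_integral_comp_inner_suffStat (hψ : ∀ u, HasDerivAt ψ (ψ' u) u)
    (hc : Continuous ψ') (hb : ∀ u, |ψ' u| ≤ K) (τ₀ τ : Param) (θ : ℝ) :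
    HasGradientAt (fun τ => ∫ x, ψ ⟪τ - τ₀, suffStat x⟫ ∂(gaussianReal θ 1))
      (∫ x, ψ' ⟪τ - τ₀, suffStat x⟫ • suffStat x ∂(gaussianReal θ 1)) τ := by
  have hcont : Continuous ψ := continuous_iff_continuousAt.2 fun u => (hψ u).continuousAt
  rw [hasGradientAt_iff_hasFDerivAt, ← LinearIsometryEquiv.coe_toContinuousLinearEquiv,
    ← ContinuousLinearEquiv.coe_coe, ← ContinuousLinearMap.integral_comp_comm _
    (integrable_bounded_smul_suffStat hc hb _ θ)]
  refine hasFDerivAt_integral_of_dominated_of_fderiv_le (bound := fun x => K * ‖suffStat x‖)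
    Filter.univ_mem (.of_forall fun τ => ?_) (integrable_comp_inner_suffStat hψ hb _ θ) ?_
    (.of_forall fun x τ _ => ?_) ((integrable_norm_suffStat θ).const_mul K)
    (.of_forall fun x τ _ => ?_) (F' := fun τ x => InnerProductSpace.toDual ℝ Param
      (ψ' ⟪τ - τ₀, suffStat x⟫ • suffStat x))
  · exact (hcont.comp (continuous_const.inner continuous_suffStat)).aestronglyMeasurable
  · exact ((InnerProductSpace.toDual ℝ Param).continuous.comp
      ((hc.comp (continuous_const.inner continuous_suffStat)).smul
      continuous_suffStat)).aestronglyMeasurable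
  · rw [LinearIsometryEquiv.norm_map, norm_smul, norm_eq_abs]
    exact mul_le_mul_of_nonneg_right (hb _) (norm_nonneg _)
  · have h1 : HasFDerivAt (fun τ : Param => ⟪τ - τ₀, suffStat x⟫)
        (innerSL ℝ (suffStat x)) τ := by
      have := ((innerSL ℝ (suffStat x)).hasFDerivAt (x := τ - τ₀)).comp τ
        ((hasFDerivAt_id τ).sub_const τ₀)
      refine (this.congr_fderiv (by ext; simp)).congr_of_eventuallyEq (.of_forall fun y => ?_)
      simp [real_inner_comm]
    refine ((hψ _).comp_hasFDerivAt τ h1).congr_fderiv ?_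
    ext y
    simp

theorem hasFDerivAt_integral_smul_suffStat (hψ : ∀ u, HasDerivAt ψ (ψ' u) u)
    {K₀ : ℝ} (hb₀ : ∀ u, |ψ u| ≤ K₀)
    (hc : Continuous ψ') (hb : ∀ u, |ψ' u| ≤ K) (τ₀ τ : Param) (θ : ℝ) :
    HasFDerivAt (fun τ => ∫ x, ψ ⟪τ - τ₀, suffStat x⟫ • suffStat x ∂(gaussianReal θ 1))
      (∫ x, ψ' ⟪τ - τ₀, suffStat x⟫ • outerStat x ∂(gaussianReal θ 1)) τ := by
  have hcont : Continuous ψ := continuous_iff_continuousAt.2 fun u => (hψ u).continuousAt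
  refine hasFDerivAt_integral_of_dominated_of_fderiv_le (bound := fun x => K * ‖suffStat x‖ ^ 2)
    Filter.univ_mem (.of_forall fun τ => ?_) (integrable_bounded_smul_suffStat hcont hb₀ _ θ) ?_
    (.of_forall fun x τ _ => ?_) ((integrable_norm_suffStat_sq θ).const_mul K)
    (.of_forall fun x τ _ => ?_) (F' := fun τ x => ψ' ⟪τ - τ₀, suffStat x⟫ • outerStat x)
  · exact ((hcont.comp (continuous_const.inner continuous_suffStat)).smul
      continuous_suffStat).aestronglyMeasurable
  · exact ((hc.comp (continuous_const.inner continuous_suffStat)).smul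
      continuous_outerStat).aestronglyMeasurable
  · rw [norm_smul, norm_eq_abs]
    exact mul_le_mul (hb _) (norm_outerStat_le x) (norm_nonneg _) ((abs_nonneg _).trans (hb 0))
  · have h1 : HasFDerivAt (fun τ : Param => ⟪τ - τ₀, suffStat x⟫)
        (innerSL ℝ (suffStat x)) τ := by
      have := ((innerSL ℝ (suffStat x)).hasFDerivAt (x := τ - τ₀)).comp τ
        ((hasFDerivAt_id τ).sub_const τ₀)
      refine (this.congr_fderiv (by ext; simp)).congr_of_eventuallyEq (.of_forall fun y => ?_)
      simp [real_inner_comm]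
    refine (((hψ _).comp_hasFDerivAt τ h1).smul_const (suffStat x)).congr_fderiv ?_
    ext y
    simp [outerStat, mul_assoc]

end IntegralCalculus

/-! ### Gradient and Hessian of the loss. -/

section Loss

theorem hasDerivAt_log_one_add_exp (u : ℝ) :
    HasDerivAt (fun u => log (1 + exp u)) (sigmoid u) u := by
  have h : (1 : ℝ) + exp u ≠ 0 := by positivity
  convert! ((Real.hasDerivAt_exp u).const_add 1).log h using 1
  rw [sigmoid_def, exp_neg]
  field_simp
  ring

theorem hasDerivAt_log_one_add_exp_neg (u : ℝ) :
    HasDerivAt (fun u => log (1 + exp (-u))) (-sigmoid (-u)) u := by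
  simpa [Function.comp_def] using HasDerivAt.comp u (hasDerivAt_log_one_add_exp (-u)) (hasDerivAt_neg u)

theorem hasDerivAt_sigmoid_eq_mul (u : ℝ) :
    HasDerivAt sigmoid (sigmoid u * sigmoid (-u)) u := by
  rw [sigmoid_neg]
  exact hasDerivAt_sigmoid u

theorem hasDerivAt_neg_sigmoid_neg (u : ℝ) :
    HasDerivAt (fun u => -sigmoid (-u)) (sigmoid u * sigmoid (-u)) u := by
  simpa [mul_comm, Function.comp_def, Pi.neg_def] using
    (HasDerivAt.comp u (hasDerivAt_sigmoid_eq_mul (-u)) (hasDerivAt_neg u)).neg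

theorem abs_sigmoid_le_one (u : ℝ) : |sigmoid u| ≤ 1 := by
  rw [abs_of_nonneg (sigmoid_nonneg u)]
  exact sigmoid_le_one u

theorem abs_neg_sigmoid_neg_le_one (u : ℝ) : |-sigmoid (-u)| ≤ 1 := by
  rw [abs_neg]
  exact abs_sigmoid_le_one _

theorem abs_sigmoid_mul_sigmoid_neg_le_one (u : ℝ) : |sigmoid u * sigmoid (-u)| ≤ 1 := by
  rw [abs_mul]
  exact mul_le_one₀ (abs_sigmoid_le_one _) (abs_nonneg _) (abs_sigmoid_le_one _)

theorem continuous_sigmoid_neg : Continuous fun u => sigmoid (-u) :=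
  continuous_sigmoid.comp continuous_neg

theorem model_eq_gaussianPDFReal_mul_exp (θ : ℝ) (τ : Param) (x : ℝ) :
    model τ x = gaussianPDFReal θ 1 x * exp ⟪τ - natParam θ, suffStat x⟫ := by
  rw [← model_natParam, model, model, mul_assoc, ← exp_add (inner ℝ _ _),
    ← inner_add_left, add_sub_cancel]

theorem log_model_add_div_model (θ : ℝ) (τ : Param) (x : ℝ) :
    log ((model τ x + gaussianPDFReal θ 1 x) / model τ x) =
      log (1 + exp (-⟪τ - natParam θ, suffStat x⟫)) := by
  have h := gaussianPDFReal_pos θ 1 x one_ne_zero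
  rw [model_eq_gaussianPDFReal_mul_exp θ, exp_neg]
  congr 1
  field_simp

theorem log_model_add_div_noise (θ : ℝ) (τ : Param) (x : ℝ) :
    log ((model τ x + gaussianPDFReal θ 1 x) / gaussianPDFReal θ 1 x) =
      log (1 + exp ⟪τ - natParam θ, suffStat x⟫) := by
  have h := gaussianPDFReal_pos θ 1 x one_ne_zero
  rw [model_eq_gaussianPDFReal_mul_exp θ]
  congr 1
  field_simp
  ring

variable (θstar θq : ℝ)

theorem gradient_loss : gradient (loss θstar θq) = fun τ =>
    (1 / 2 : ℝ) • ∫ x, (-sigmoid (-⟪τ - natParam θq, suffStat x⟫)) • suffStat x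
        ∂(gaussianReal θstar 1)
      + (1 / 2 : ℝ) • ∫ x, sigmoid ⟪τ - natParam θq, suffStat x⟫ • suffStat x
        ∂(gaussianReal θq 1) := by
  funext τ
  refine HasGradientAt.gradient ?_
  have h1 := (hasGradientAt_integral_comp_inner_suffStat hasDerivAt_log_one_add_exp_neg
    continuous_sigmoid_neg.neg abs_neg_sigmoid_neg_le_one (natParam θq) τ θstar).hasFDerivAt
  have h2 := (hasGradientAt_integral_comp_inner_suffStat hasDerivAt_log_one_add_exp
    continuous_sigmoid abs_sigmoid_le_one (natParam θq) τ θq).hasFDerivAt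
  have h3 := (h1.const_mul (1 / 2)).add (h2.const_mul (1 / 2))
  rw [hasGradientAt_iff_hasFDerivAt]
  unfold loss
  simp_rw [log_model_add_div_model, log_model_add_div_noise]
  refine h3.congr_fderiv ?_
  simp

theorem hessian_eq (τ : Param) : hessian θstar θq τ =
    (1 / 2 : ℝ) • (∫ x, (sigmoid ⟪τ - natParam θq, suffStat x⟫ *
        sigmoid (-⟪τ - natParam θq, suffStat x⟫)) • outerStat x ∂(gaussianReal θstar 1))
      + (1 / 2 : ℝ) • (∫ x, (sigmoid ⟪τ - natParam θq, suffStat x⟫ *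
        sigmoid (-⟪τ - natParam θq, suffStat x⟫)) • outerStat x ∂(gaussianReal θq 1)) := by
  rw [hessian, gradient_loss]
  refine HasFDerivAt.fderiv ?_
  have hc : Continuous fun u => sigmoid u * sigmoid (-u) :=
    continuous_sigmoid.mul continuous_sigmoid_neg
  have h1 := hasFDerivAt_integral_smul_suffStat hasDerivAt_neg_sigmoid_neg
    abs_neg_sigmoid_neg_le_one hc abs_sigmoid_mul_sigmoid_neg_le_one (natParam θq) τ θstar
  have h2 := hasFDerivAt_integral_smul_suffStat hasDerivAt_sigmoid_eq_mul
    abs_sigmoid_le_one hc abs_sigmoid_mul_sigmoid_neg_le_one (natParam θq) τ θq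
  exact (h1.const_smul (1 / 2 : ℝ)).add (h2.const_smul (1 / 2 : ℝ))

theorem integrable_gaussianReal_iff (θ : ℝ) (f : ℝ → ℝ) :
    Integrable f (gaussianReal θ 1) ↔ Integrable fun x => gaussianPDFReal θ 1 x * f x := by
  rw [gaussianReal_of_var_ne_zero θ one_ne_zero,
    integrable_withDensity_iff_integrable_smul' (measurable_gaussianPDF θ 1)
      (.of_forall fun x => gaussianPDF_lt_top)]
  simp [toReal_gaussianPDF]

theorem integral_gaussianReal_eq (θ : ℝ) (f : ℝ → ℝ) :
    ∫ x, f x ∂(gaussianReal θ 1) = ∫ x, gaussianPDFReal θ 1 x * f x :=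
  integral_gaussianReal_eq_integral_smul one_ne_zero

/-- The log density ratio `⟨τ - τ_q, T(x)⟩` of the model to the noise. -/
noncomputable def logit (θq : ℝ) (τ : Param) (x : ℝ) : ℝ := ⟪τ - natParam θq, suffStat x⟫

variable {θstar θq}

theorem integrable_bounded_mul_inner_suffStat {ψ : ℝ → ℝ} {K : ℝ} (hc : Continuous ψ)
    (hb : ∀ u, |ψ u| ≤ K) (τ d : Param) (θ : ℝ) :
    Integrable (fun x => ψ (logit θq τ x) * ⟪d, suffStat x⟫) (gaussianReal θ 1) := by
  have h := (integrable_bounded_smul_suffStat hc hb (τ - natParam θq) θ).const_inner (𝕜 := ℝ) d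
  simpa only [logit, inner_smul_right] using h

theorem integrable_bounded_mul_inner_suffStat_mul {ψ : ℝ → ℝ} {K : ℝ} (hc : Continuous ψ)
    (hb : ∀ u, |ψ u| ≤ K) (τ d e : Param) (θ : ℝ) :
    Integrable (fun x => ψ (logit θq τ x) * (⟪d, suffStat x⟫ * ⟪e, suffStat x⟫))
      (gaussianReal θ 1) := by
  have h := ((integrable_bounded_smul_outerStat hc hb (τ - natParam θq) θ).apply_continuousLinearMap
    d).const_inner (𝕜 := ℝ) e
  simpa only [logit, smul_apply, outerStat_apply, inner_smul_right] using h

theorem inner_gradient_loss (τ d : Param) :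
    ⟪d, gradient (loss θstar θq) τ⟫ =
      1 / 2 * ∫ x, sigmoid (logit θq τ x) * ⟪d, suffStat x⟫ ∂(gaussianReal θq 1)
      - 1 / 2 * ∫ x, sigmoid (-logit θq τ x) * ⟪d, suffStat x⟫ ∂(gaussianReal θstar 1) := by
  rw [gradient_loss, inner_add_right, inner_smul_right, inner_smul_right, ← integral_inner,
    ← integral_inner]
  · simp only [inner_smul_right, neg_mul, integral_neg]
    simp only [logit]
    ring
  · exact integrable_bounded_smul_suffStat continuous_sigmoid abs_sigmoid_le_one _ _
  · exact integrable_bounded_smul_suffStat continuous_sigmoid_neg.neg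
      abs_neg_sigmoid_neg_le_one _ _

theorem continuous_sigmoid_mul_sigmoid_neg : Continuous fun u => sigmoid u * sigmoid (-u) :=
  continuous_sigmoid.mul continuous_sigmoid_neg

theorem inner_hessian (τ d e : Param) :
    ⟪e, hessian θstar θq τ d⟫ =
      1 / 2 * ∫ x, sigmoid (logit θq τ x) * sigmoid (-logit θq τ x) *
        (⟪d, suffStat x⟫ * ⟪e, suffStat x⟫) ∂(gaussianReal θq 1)
      + 1 / 2 * ∫ x, sigmoid (logit θq τ x) * sigmoid (-logit θq τ x) *
        (⟪d, suffStat x⟫ * ⟪e, suffStat x⟫) ∂(gaussianReal θstar 1) := by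
  have hi (θ : ℝ) := integrable_bounded_smul_outerStat continuous_sigmoid_mul_sigmoid_neg
    abs_sigmoid_mul_sigmoid_neg_le_one (τ - natParam θq) θ
  rw [hessian_eq, add_apply, smul_apply,
    smul_apply, ContinuousLinearMap.integral_apply (hi _),
    ContinuousLinearMap.integral_apply (hi _), inner_add_right, inner_smul_right,
    inner_smul_right, ← integral_inner ((hi _).apply_continuousLinearMap _),
    ← integral_inner ((hi _).apply_continuousLinearMap _), add_comm]
  simp only [smul_apply, outerStat_apply, inner_smul_right, logit]

/-- Passing to a single Lebesgue integral makes the reflection `x ↦ R - x` and pointwise bounds by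
`p_* + q` available. -/
theorem inner_gradient_loss_eq_integral (τ d : Param) :
    ⟪d, gradient (loss θstar θq) τ⟫ =
      1 / 2 * ∫ x, (sigmoid (logit θq τ x) * gaussianPDFReal θq 1 x
        - sigmoid (-logit θq τ x) * gaussianPDFReal θstar 1 x) * ⟪d, suffStat x⟫ := by
  rw [inner_gradient_loss, integral_gaussianReal_eq, integral_gaussianReal_eq, ← mul_sub,
    ← integral_sub]
  · congr 2
    funext x
    ring
  · exact (integrable_gaussianReal_iff _ _).1 (integrable_bounded_mul_inner_suffStat
      continuous_sigmoid abs_sigmoid_le_one _ _ _)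
  · exact (integrable_gaussianReal_iff _ _).1 (integrable_bounded_mul_inner_suffStat
      continuous_sigmoid_neg (fun u => abs_sigmoid_le_one _) _ _ _)

/-- The density of the Hessian: `σ(u) σ(-u) (p_* + q)`. -/
noncomputable def hessianWeight (θstar θq : ℝ) (τ : Param) (x : ℝ) : ℝ :=
  sigmoid (logit θq τ x) * sigmoid (-logit θq τ x) *
    (gaussianPDFReal θq 1 x + gaussianPDFReal θstar 1 x)

theorem hessianWeight_pos (τ : Param) (x : ℝ) : 0 < hessianWeight θstar θq τ x :=
  mul_pos (mul_pos (sigmoid_pos _) (sigmoid_pos _))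
    (add_pos (gaussianPDFReal_pos _ _ _ one_ne_zero) (gaussianPDFReal_pos _ _ _ one_ne_zero))

theorem integrable_hessianWeight_mul (τ d e : Param) :
    Integrable fun x => hessianWeight θstar θq τ x * (⟪d, suffStat x⟫ * ⟪e, suffStat x⟫) := by
  have hi (θ : ℝ) := (integrable_gaussianReal_iff _ _).1
    (integrable_bounded_mul_inner_suffStat_mul continuous_sigmoid_mul_sigmoid_neg
      abs_sigmoid_mul_sigmoid_neg_le_one (θq := θq) τ d e θ)
  refine ((hi θq).add (hi θstar)).congr (.of_forall fun x => ?_)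
  simp only [Pi.add_apply, hessianWeight]
  ring

theorem inner_hessian_eq_integral (τ d e : Param) :
    ⟪e, hessian θstar θq τ d⟫ =
      1 / 2 * ∫ x, hessianWeight θstar θq τ x * (⟪d, suffStat x⟫ * ⟪e, suffStat x⟫) := by
  have hi (θ : ℝ) := (integrable_gaussianReal_iff _ _).1
    (integrable_bounded_mul_inner_suffStat_mul continuous_sigmoid_mul_sigmoid_neg
      abs_sigmoid_mul_sigmoid_neg_le_one (θq := θq) τ d e θ)
  rw [inner_hessian, integral_gaussianReal_eq, integral_gaussianReal_eq, ← mul_add,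
    ← integral_add (hi _) (hi _)]
  congr 2
  funext x
  simp only [hessianWeight]
  ring

theorem continuous_logit (τ : Param) : Continuous (logit θq τ) :=
  continuous_const.inner continuous_suffStat

theorem continuous_gaussianPDFReal (θ : ℝ) : Continuous (gaussianPDFReal θ 1) := by
  rw [gaussianPDFReal_def]
  fun_prop

theorem continuous_hessianWeight (τ : Param) : Continuous (hessianWeight θstar θq τ) :=
  (continuous_sigmoid_mul_sigmoid_neg.comp (continuous_logit τ)).mul
    ((continuous_gaussianPDFReal _).add (continuous_gaussianPDFReal _))

/-- The weight is positive everywhere, and the affine function `⟪d, T(x)⟫` can vanish at both `0`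
and `1` only if `d = 0`. -/
theorem inner_hessian_self_pos (τ : Param) {d : Param} (hd : d ≠ 0) :
    0 < ⟪d, hessian θstar θq τ d⟫ := by
  rw [inner_hessian_eq_integral]
  refine mul_pos (by norm_num) ?_
  obtain ⟨x, hx⟩ : ∃ x, ⟪d, suffStat x⟫ ≠ 0 := by
    by_contra! h
    have h0 := h 0
    have h1 := h 1
    rw [inner_suffStat] at h0 h1
    apply hd
    ext i
    fin_cases i <;> simp <;> linarith
  refine integral_pos_of_integrable_nonneg_nonzero (x := x) ?_
    (integrable_hessianWeight_mul _ _ _) (fun y => ?_) ?_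
  · have : Continuous fun x => ⟪d, suffStat x⟫ := continuous_const.inner continuous_suffStat
    exact (continuous_hessianWeight τ).mul (this.mul this)
  · exact mul_nonneg (hessianWeight_pos _ _).le (mul_self_nonneg _)
  · exact mul_ne_zero (hessianWeight_pos _ _).ne' (mul_self_ne_zero.2 hx)

theorem isInvertible_hessian (τ : Param) : (hessian θstar θq τ).IsInvertible := by
  have hinj : Function.Injective (hessian θstar θq τ) := by
    rw [injective_iff_map_eq_zero]
    intro d hd
    by_contra h
    have := inner_hessian_self_pos (θstar := θstar) (θq := θq) τ h
    rw [hd, inner_zero_right] at this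
    exact lt_irrefl _ this
  let e := (LinearEquiv.ofInjectiveEndo (hessian θstar θq τ : Param →ₗ[ℝ] Param)
    hinj).toContinuousLinearEquiv
  exact ⟨e, by ext1 d; rfl⟩

theorem hessian_apply_inverse (τ g : Param) :
    hessian θstar θq τ ((hessian θstar θq τ).inverse g) = g := by
  obtain ⟨e, he⟩ := isInvertible_hessian (θstar := θstar) (θq := θq) τ
  rw [← he, ContinuousLinearMap.inverse_equiv]
  simp

theorem inverse_hessian_eq {τ g d : Param} (h : hessian θstar θq τ d = g) :
    (hessian θstar θq τ).inverse g = d := by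
  obtain ⟨e, he⟩ := isInvertible_hessian (θstar := θstar) (θq := θq) τ
  rw [← h, ← he, ContinuousLinearMap.inverse_equiv]
  simp

end Loss

/-! ### The symmetry axis from noise to optimum. -/

theorem logit_zero_eq (τ : Param) (x : ℝ) :
    logit 0 τ x = τ 0 * x - (τ 1 - log (√(2 * π))) := by
  rw [logit, inner_suffStat]
  simp [natParam]

/-- The direction `(1, R / 2)` from `τ_q` to `τ_*`. -/
noncomputable def axis (R : ℝ) : Param := !₂[1, R / 2]

theorem inner_axis_suffStat (R x : ℝ) : ⟪axis R, suffStat x⟫ = x - R / 2 := by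
  rw [inner_suffStat]
  simp [axis]

theorem natParam_eq_add_smul_axis (R : ℝ) : natParam R = natParam 0 + R • axis R := by
  ext i
  fin_cases i <;> simp [natParam, axis]
  ring

theorem logit_add_smul_axis (R b x : ℝ) :
    logit 0 (natParam 0 + b • axis R) x = b * (x - R / 2) := by
  rw [logit, add_sub_cancel_left, real_inner_smul_left, inner_axis_suffStat]

theorem half_le_norm_axis (R : ℝ) : R / 2 ≤ ‖axis R‖ := by
  have h := PiLp.norm_apply_le (axis R) 1
  simp only [axis, PiLp.toLp_apply, Matrix.cons_val_one, Matrix.cons_val_fin_one,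
    norm_eq_abs] at h
  exact (le_abs_self _).trans h

theorem gaussianPDFReal_sub_left (R x : ℝ) :
    gaussianPDFReal 0 1 (R - x) = gaussianPDFReal R 1 x := by
  simp only [gaussianPDFReal]
  congr 3
  ring

theorem gaussianPDFReal_sub_left' (R x : ℝ) :
    gaussianPDFReal R 1 (R - x) = gaussianPDFReal 0 1 x := by
  rw [← gaussianPDFReal_sub_left, sub_sub_cancel]

theorem integral_eq_zero_of_sub_left_eq_neg {f : ℝ → ℝ} (R : ℝ) (h : ∀ x, f (R - x) = -f x) :
    ∫ x, f x = 0 := by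
  have h1 := integral_sub_left_eq_self f volume R
  simp_rw [h, integral_neg] at h1
  linarith

/-- The hypothesis kills the second coordinate, and `axis R` has first coordinate `1`, so pairing
with it reads off what remains. -/
theorem eq_inner_axis_smul (R : ℝ) {w : Param} (h : ⟪(!₂[0, -1] : Param), w⟫ = 0) :
    w = ⟪axis R, w⟫ • !₂[1, 0] := by
  simp only [PiLp.inner_apply, Fin.sum_univ_two] at h
  simp at h
  ext i
  fin_cases i <;> simp [axis, PiLp.inner_apply, Fin.sum_univ_two, h]

theorem inner_const_suffStat (x : ℝ) : ⟪(!₂[0, -1] : Param), suffStat x⟫ = 1 := by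
  rw [inner_suffStat]
  simp

/-- On the axis the logit is odd about `R / 2`, so the Hessian weight is even under `x ↦ R - x`
while `x - R / 2` is odd; the second component integrates to zero. -/
theorem hessian_axis (R b : ℝ) :
    hessian R 0 (natParam 0 + b • axis R) (axis R) =
      ⟪axis R, hessian R 0 (natParam 0 + b • axis R) (axis R)⟫ • !₂[1, 0] := by
  refine eq_inner_axis_smul R ?_
  rw [inner_hessian_eq_integral, integral_eq_zero_of_sub_left_eq_neg R, mul_zero]
  intro x
  simp only [hessianWeight, logit_add_smul_axis, gaussianPDFReal_sub_left,
    gaussianPDFReal_sub_left', inner_const_suffStat, inner_axis_suffStat]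
  rw [show b * (R - x - R / 2) = -(b * (x - R / 2)) by ring, neg_neg]
  ring

/-- The gradient density changes sign under `x ↦ R - x`. Gradient and `H (axis R)` are therefore
parallel, which is why Newton steps do not leave the axis. -/
theorem gradient_loss_axis (R b : ℝ) :
    gradient (loss R 0) (natParam 0 + b • axis R) =
      ⟪axis R, gradient (loss R 0) (natParam 0 + b • axis R)⟫ • !₂[1, 0] := by
  refine eq_inner_axis_smul R ?_
  rw [inner_gradient_loss_eq_integral, integral_eq_zero_of_sub_left_eq_neg R, mul_zero]
  intro x
  simp only [logit_add_smul_axis, gaussianPDFReal_sub_left,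
    gaussianPDFReal_sub_left', inner_const_suffStat]
  rw [show b * (R - x - R / 2) = -(b * (x - R / 2)) by ring, neg_neg]
  ring

/-! ### Conditioning of the Hessian and the step size. -/

theorem sq_half_le_exp_add_exp_neg (v : ℝ) : v ^ 2 / 2 ≤ exp v + exp (-v) := by
  rcases le_total 0 v with h | h
  · linarith [quadratic_le_exp_of_nonneg h, exp_pos (-v)]
  · have := quadratic_le_exp_of_nonneg (neg_nonneg.2 h)
    rw [neg_sq] at this
    linarith [exp_pos v]

theorem sigmoid_eq_exp_half_div (u : ℝ) :
    sigmoid u = exp (u / 2) / (exp (u / 2) + exp (-(u / 2))) := by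
  have h : exp (-u) = exp (-(u / 2)) * exp (-(u / 2)) := by
    rw [← exp_add]
    ring_nf
  have h1 : exp (u / 2) * exp (-(u / 2)) = 1 := by rw [← exp_add]; simp
  have h2 := exp_pos (u / 2)
  have h3 := exp_pos (-(u / 2))
  rw [sigmoid_def, h, eq_div_iff (by positivity), inv_mul_eq_iff_eq_mul₀ (by positivity)]
  linear_combination -exp (-(u / 2)) * h1

theorem gaussianPDFReal_zero_eq_mul (R x : ℝ) :
    gaussianPDFReal 0 1 x =
      gaussianPDFReal (R / 2) 1 x * exp (-R ^ 2 / 8) * exp (-(R * (x - R / 2) / 2)) := by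
  simp only [gaussianPDFReal, NNReal.coe_one, mul_one]
  rw [mul_assoc, mul_assoc, ← exp_add, ← exp_add]
  congr 2
  ring

theorem gaussianPDFReal_eq_mul (R x : ℝ) :
    gaussianPDFReal R 1 x =
      gaussianPDFReal (R / 2) 1 x * exp (-R ^ 2 / 8) * exp (R * (x - R / 2) / 2) := by
  simp only [gaussianPDFReal, NNReal.coe_one, mul_one]
  rw [mul_assoc, mul_assoc, ← exp_add, ← exp_add]
  congr 2
  ring

/-- Let `v = R (x - R / 2) / 2` and let `G` be the density of `N(R / 2, 1)`. Then `p_* + q = G exp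
(-R² / 8) (e^v + e^{-v})` and `σ σ' = (e^v + e^{-v})⁻²`, so the weight is `G exp (-R² / 8) / (e^v +
e^{-v})`. The remaining denominator absorbs `v²`, which gains the factor `R⁻²`. -/
theorem hessianWeight_optimum_mul_sq_le {R : ℝ} (hR : 0 < R) (x : ℝ) :
    hessianWeight R 0 (natParam 0 + R • axis R) x * (x - R / 2) ^ 2 ≤
      8 / R ^ 2 * exp (-R ^ 2 / 8) * gaussianPDFReal (R / 2) 1 x := by
  have hv := sq_half_le_exp_add_exp_neg (R * (x - R / 2) / 2)
  have hG := gaussianPDFReal_nonneg (R / 2) 1 x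
  have hprod : exp (R * (x - R / 2) / 2) * exp (-(R * (x - R / 2) / 2)) = 1 := by
    rw [← exp_add]; simp
  rw [hessianWeight, logit_add_smul_axis, sigmoid_eq_exp_half_div, sigmoid_eq_exp_half_div,
    gaussianPDFReal_zero_eq_mul R, gaussianPDFReal_eq_mul R, neg_div, neg_neg]
  set s := exp (R * (x - R / 2) / 2)
  set s' := exp (-(R * (x - R / 2) / 2))
  have hs : 0 < s := exp_pos _
  have hs' : 0 < s' := exp_pos _
  have hsq : (x - R / 2) ^ 2 ≤ 8 / R ^ 2 * (s + s') := by
    rw [div_mul_eq_mul_div, le_div_iff₀ (by positivity)]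
    linarith
  set E := exp (-R ^ 2 / 8)
  set G := gaussianPDFReal (R / 2) 1 x
  have hE : 0 < E := exp_pos _
  calc _ = G * E / (s + s') * (x - R / 2) ^ 2 := by
        have : s / (s + s') * (s' / (s' + s)) = 1 / (s + s') ^ 2 := by
          rw [div_mul_div_comm, hprod, add_comm s' s, sq]
        rw [this]
        field_simp
        ring
    _ ≤ G * E / (s + s') * (8 / R ^ 2 * (s + s')) := by gcongr
    _ = _ := by field_simp

theorem inner_axis_hessian_optimum_le {R : ℝ} (hR : 0 < R) :
    ⟪axis R, hessian R 0 (natParam R) (axis R)⟫ ≤ 4 * exp (-R ^ 2 / 8) / R ^ 2 := by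
  have h1 : ∫ x, 8 / R ^ 2 * exp (-R ^ 2 / 8) * gaussianPDFReal (R / 2) 1 x =
      8 / R ^ 2 * exp (-R ^ 2 / 8) := by
    rw [integral_const_mul, integral_gaussianPDFReal_eq_one _ one_ne_zero, mul_one]
  rw [natParam_eq_add_smul_axis, inner_hessian_eq_integral]
  have h2 := integral_mono (integrable_hessianWeight_mul (θstar := R) (θq := 0)
    (natParam 0 + R • axis R) (axis R) (axis R))
    ((integrable_gaussianPDFReal (R / 2) 1).const_mul (8 / R ^ 2 * exp (-R ^ 2 / 8)))
    (fun x => by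
      simp only [inner_axis_suffStat, ← sq]
      exact hessianWeight_optimum_mul_sq_le hR x)
  rw [h1] at h2
  calc _ ≤ 1 / 2 * (8 / R ^ 2 * exp (-R ^ 2 / 8)) := by gcongr
    _ = _ := by ring

theorem sigmaMin_hessian_optimum_le {R : ℝ} (hR : 0 < R) :
    sigmaMin (hessian R 0 (natParam R)) ≤ 8 * exp (-R ^ 2 / 8) / R ^ 3 := by
  have h1 := singularValues_last_mul_norm_le (hessian R 0 (natParam R) : Param →ₗ[ℝ] Param)
    (n := 1) (by simp) (axis R)
  have h2 : ‖hessian R 0 (natParam R) (axis R)‖ ≤ 4 * exp (-R ^ 2 / 8) / R ^ 2 := by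
    have h3 := inner_axis_hessian_optimum_le hR
    have h4 := hessian_axis R R
    rw [← natParam_eq_add_smul_axis] at h4
    have h5 : 0 < ⟪axis R, hessian R 0 (natParam R) (axis R)⟫ := by
      refine inner_hessian_self_pos _ fun h => ?_
      have := congrArg (fun d : Param => d 0) h
      simp [axis] at this
    have h6 : ‖(!₂[1, 0] : Param)‖ = 1 := by simp [EuclideanSpace.norm_eq]
    rw [h4, norm_smul, h6, mul_one, norm_eq_abs, abs_of_pos h5]
    exact h3
  have h3 : sigmaMin (hessian R 0 (natParam R)) * (R / 2) ≤ 4 * exp (-R ^ 2 / 8) / R ^ 2 :=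
    (mul_le_mul_of_nonneg_left (half_le_norm_axis R)
      (LinearMap.singularValues_nonneg _ _)).trans (h1.trans h2)
  rw [le_div_iff₀ (by positivity)] at h3 ⊢
  nlinarith

theorem sq_le_sigmaMax_hessian_noise (R : ℝ) :
    R ^ 2 / 8 ≤ sigmaMax (hessian R 0 (natParam 0)) := by
  have h1 := norm_apply_le_singularValues_zero (hessian R 0 (natParam 0) : Param →ₗ[ℝ] Param)
    !₂[1, 0]
  have h6 : ‖(!₂[1, 0] : Param)‖ = 1 := by simp [EuclideanSpace.norm_eq]
  have h2 := real_inner_le_norm (!₂[1, 0] : Param) (hessian R 0 (natParam 0) !₂[1, 0])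
  rw [h6, mul_one] at h1
  rw [h6, one_mul] at h2
  refine le_trans ?_ (h2.trans h1)
  have hl (x : ℝ) : logit 0 (natParam 0) x = 0 := by simp [logit]
  have hT (x : ℝ) : ⟪(!₂[1, 0] : Param), suffStat x⟫ = x := by rw [inner_suffStat]; simp
  rw [inner_hessian]
  simp only [hl, hT, neg_zero, sigmoid_zero, ← sq, integral_const_mul]
  have h3 : 0 ≤ ∫ x : ℝ, x ^ 2 ∂(gaussianReal 0 1) := integral_nonneg fun x => sq_nonneg x
  -- Integrate the tangent line `2 R x - R² ≤ x²` at the mean.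
  have h4 : R ^ 2 ≤ ∫ x : ℝ, x ^ 2 ∂(gaussianReal R 1) := by
    have hi : Integrable (fun x : ℝ => x) (gaussianReal R 1) :=
      (memLp_id_gaussianReal (μ := R) (v := 1) 1).integrable le_rfl
    have h5 : ∫ x : ℝ, (2 * R * x - R ^ 2) ∂(gaussianReal R 1) = R ^ 2 := by
      rw [integral_sub (hi.const_mul _) (integrable_const _), integral_const_mul,
        integral_id_gaussianReal]
      simp
      ring
    rw [← h5]
    refine integral_mono ((hi.const_mul _).sub (integrable_const _))
      (integrable_sq_gaussianReal R) fun x => ?_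
    change 2 * R * x - R ^ 2 ≤ x ^ 2
    nlinarith [sq_nonneg (x - R)]
  linarith

/-- Makes the set defining `lambdaM` bounded above, so that its `sSup` is a genuine supremum and
dominates the value at the noise parameter. -/
theorem exists_norm_hessian_le (θstar θq : ℝ) : ∃ K, 0 ≤ K ∧ ∀ τ, ‖hessian θstar θq τ‖ ≤ K := by
  have h (τ : Param) (θ : ℝ) := norm_integral_le_of_norm_le (integrable_norm_suffStat_sq θ)
    (f := fun x => (sigmoid ⟪τ - natParam θq, suffStat x⟫ *
      sigmoid (-⟪τ - natParam θq, suffStat x⟫)) • outerStat x) (.of_forall fun x => by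
      rw [norm_smul, norm_eq_abs]
      exact (mul_le_of_le_one_left (norm_nonneg _)
        (abs_sigmoid_mul_sigmoid_neg_le_one _)).trans (norm_outerStat_le x))
  refine ⟨1 / 2 * ∫ x, ‖suffStat x‖ ^ 2 ∂(gaussianReal θstar 1) +
    1 / 2 * ∫ x, ‖suffStat x‖ ^ 2 ∂(gaussianReal θq 1), by positivity, fun τ => ?_⟩
  rw [hessian_eq]
  refine (norm_add_le _ _).trans ?_
  rw [norm_smul, norm_smul, norm_of_nonneg (by norm_num : (0 : ℝ) ≤ 1 / 2)]
  gcongr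
  · exact h τ θstar
  · exact h τ θq

theorem lambdaRho_le {R : ℝ} (hR : 0 < R) {Θ : Set ℝ} (hΘ : R ∈ Θ) :
    lambdaRho R 0 Θ ≤ 8 * exp (-R ^ 2 / 8) / R ^ 3 := by
  refine (csInf_le ⟨0, ?_⟩ (mem_image_of_mem _ hΘ)).trans (sigmaMin_hessian_optimum_le hR)
  rintro _ ⟨θ, -, rfl⟩
  exact LinearMap.singularValues_nonneg _ _

theorem le_lambdaM (R : ℝ) {Θ : Set ℝ} (hΘ : 0 ∈ Θ) : R ^ 2 / 8 ≤ lambdaM R 0 Θ := by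
  obtain ⟨K, hK, hH⟩ := exists_norm_hessian_le R 0
  refine (sq_le_sigmaMax_hessian_noise R).trans
    (le_csSup ⟨K, ?_⟩ (mem_image_of_mem (fun θ => sigmaMax (hessian R 0 (natParam θ))) hΘ))
  rintro _ ⟨θ, -, rfl⟩
  exact singularValues_le_of_norm_le _ hK (fun v => (hessian R 0 (natParam θ)).le_of_opNorm_le
    (hH _) v) _

theorem stepSize_le {C R η : ℝ} (hC : 0 < C) (hR : 0 < R) {Θ : Set ℝ} (h0 : 0 ∈ Θ) (h1 : R ∈ Θ)
    (hη : η ≤ C * (lambdaRho R 0 Θ / lambdaM R 0 Θ)) :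
    η ≤ 64 * C * exp (-R ^ 2 / 8) / R ^ 5 := by
  have h2 := lambdaRho_le hR h1
  have h3 := le_lambdaM R h0
  calc η ≤ C * (lambdaRho R 0 Θ / lambdaM R 0 Θ) := hη
    _ ≤ C * (8 * exp (-R ^ 2 / 8) / R ^ 3 / (R ^ 2 / 8)) := by gcongr
    _ = _ := by field_simp; ring

/-! ### Estimates around the decision boundary `x₀`. -/

theorem integral_exp_neg_mul_abs_sub {a : ℝ} (ha : 0 < a) (x₀ : ℝ) :
    ∫ x, exp (-a * |x - x₀|) = 2 / a := by
  rw [integral_sub_right_eq_self (fun x => exp (-a * |x|)),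
    integral_comp_abs (f := fun x => exp (-a * x)), integral_exp_mul_Ioi (neg_lt_zero.2 ha)]
  simp
  ring

theorem integrable_exp_neg_mul_abs_sub {a : ℝ} (ha : 0 < a) (x₀ : ℝ) :
    Integrable fun x => exp (-a * |x - x₀|) := by
  -- A non-integrable function has Bochner integral `0` by convention, so a nonzero value certifies
  -- integrability.
  refine .of_integral_ne_zero ?_
  rw [integral_exp_neg_mul_abs_sub ha]
  positivity

theorem gaussianPDFReal_eq_mul_exp (θ x₀ x : ℝ) :
    gaussianPDFReal θ 1 x =
      gaussianPDFReal θ 1 x₀ * exp (-(x₀ - θ) * (x - x₀) - (x - x₀) ^ 2 / 2) := by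
  simp only [gaussianPDFReal, NNReal.coe_one, mul_one]
  rw [mul_assoc, ← exp_add]
  congr 2
  ring

theorem exp_mul_gaussianPDFReal_le {θ x₀ x R : ℝ} (hR : 1 ≤ R) (hθ : |x₀ - θ| ≤ R)
    (hx : |x - x₀| ≤ 1 / R) :
    exp (-2) * gaussianPDFReal θ 1 x₀ ≤ gaussianPDFReal θ 1 x := by
  have h1 : |(x₀ - θ) * (x - x₀)| ≤ 1 := by
    rw [abs_mul]
    calc _ ≤ R * (1 / R) := by gcongr
      _ = 1 := by field_simp
  have h2 : |x - x₀| ≤ 1 := hx.trans (by rw [div_le_one (by linarith)]; exact hR)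
  have h3 : (x - x₀) ^ 2 ≤ 1 := (sq_le_one_iff_abs_le_one _).2 h2
  rw [gaussianPDFReal_eq_mul_exp θ x₀ x, mul_comm]
  refine mul_le_mul_of_nonneg_left (exp_le_exp.2 ?_) (gaussianPDFReal_nonneg _ _ _)
  linarith [(abs_le.1 h1).2]

theorem gaussianPDFReal_le_exp_mul {θ x₀ x R : ℝ} (hR : 0 < R) (hθ : |x₀ - θ| ≤ R)
    (hx : |x - x₀| ≤ 1 / R) :
    gaussianPDFReal θ 1 x ≤ exp 1 * gaussianPDFReal θ 1 x₀ := by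
  have h1 : |(x₀ - θ) * (x - x₀)| ≤ 1 := by
    rw [abs_mul]
    calc _ ≤ R * (1 / R) := by gcongr
      _ = 1 := by field_simp
  rw [gaussianPDFReal_eq_mul_exp θ x₀ x, mul_comm]
  refine mul_le_mul_of_nonneg_right (exp_le_exp.2 ?_) (gaussianPDFReal_nonneg _ _ _)
  nlinarith [(abs_le.1 h1).1, sq_nonneg (x - x₀)]

theorem sigmoid_le_exp (u : ℝ) : sigmoid u ≤ exp u := by
  have h := sigmoid_mul_rexp_neg (-u)
  rw [neg_neg] at h
  rw [← h]
  exact mul_le_of_le_one_left (exp_pos _).le (sigmoid_le_one _)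

/-- To the right of `x₀` the Gaussian decays at rate at least `x₀ - θ`. To the left it may grow at
that rate, but the sigmoid decays at rate `b`; both net rates are at least `κ`. -/
theorem sigmoid_mul_gaussianPDFReal_le {θ x₀ b κ : ℝ} (h₁ : κ ≤ x₀ - θ) (h₂ : x₀ - θ + κ ≤ b)
    (x : ℝ) :
    sigmoid (b * (x - x₀)) * gaussianPDFReal θ 1 x ≤
      gaussianPDFReal θ 1 x₀ * exp (-κ * |x - x₀|) := by
  have h3 : sigmoid (b * (x - x₀)) ≤ exp (min 0 (b * (x - x₀))) := by
    rcases le_total 0 (b * (x - x₀)) with h | h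
    · rw [min_eq_left h, exp_zero]
      exact sigmoid_le_one _
    · rw [min_eq_right h]
      exact sigmoid_le_exp _
  rw [gaussianPDFReal_eq_mul_exp θ x₀ x, mul_left_comm]
  refine mul_le_mul_of_nonneg_left ?_ (gaussianPDFReal_nonneg _ _ _)
  refine (mul_le_mul_of_nonneg_right h3 (exp_pos _).le).trans ?_
  rw [← exp_add, exp_le_exp]
  rcases le_total 0 (x - x₀) with h | h
  · rw [abs_of_nonneg h]
    nlinarith [min_le_left 0 (b * (x - x₀)), mul_le_mul_of_nonneg_right h₁ h, sq_nonneg (x - x₀)]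
  · rw [abs_of_nonpos h]
    nlinarith [min_le_right 0 (b * (x - x₀)), mul_le_mul_of_nonpos_right h₂ h, sq_nonneg (x - x₀)]

theorem sigmoid_neg_mul_gaussianPDFReal_le {θ x₀ b κ : ℝ} (h₁ : κ ≤ θ - x₀)
    (h₂ : θ - x₀ + κ ≤ b) (x : ℝ) :
    sigmoid (-(b * (x - x₀))) * gaussianPDFReal θ 1 x ≤
      gaussianPDFReal θ 1 x₀ * exp (-κ * |x - x₀|) := by
  have h := sigmoid_mul_gaussianPDFReal_le (θ := 0) (x₀ := θ - x₀) (b := b) (κ := κ)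
    (by linarith) (by linarith) (θ - x)
  rwa [gaussianPDFReal_sub_left, gaussianPDFReal_sub_left, sub_sub_sub_cancel_left,
    abs_sub_comm, show b * (x₀ - x) = -(b * (x - x₀)) by ring] at h

theorem sq_sigmoid_neg_two_le {u : ℝ} (hu : |u| ≤ 2) :
    sigmoid (-2) ^ 2 ≤ sigmoid u * sigmoid (-u) := by
  have h := abs_le.1 hu
  rw [sq]
  exact mul_le_mul (sigmoid_le (by linarith)) (sigmoid_le (by linarith)) (sigmoid_nonneg _)
    (sigmoid_nonneg _)

/-- Lower bound for the ratio of the Hessian density near the decision boundary to the density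
`p_* + q` on the boundary. -/
noncomputable def weightConst : ℝ := sigmoid (-2) ^ 2 * exp (-2)

theorem weightConst_pos : 0 < weightConst :=
  mul_pos (pow_pos (sigmoid_pos _) 2) (exp_pos _)

section Boundary

variable {R x₀ b : ℝ} {τ : Param}

/-- At scale `1 / R` the logit stays in `[-2, 2]` and both Gaussian densities keep at least a
fraction `exp (-2)` of their boundary values. -/
theorem weightConst_mul_le_hessianWeight (hR : 1 ≤ R) (h0 : |x₀| ≤ R) (h1 : |x₀ - R| ≤ R)
    (hb : |b| ≤ 2 * R) (hl : ∀ x, logit 0 τ x = b * (x - x₀)) {x : ℝ} (hx : |x - x₀| ≤ 1 / R) :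
    weightConst * (gaussianPDFReal 0 1 x₀ + gaussianPDFReal R 1 x₀) ≤ hessianWeight R 0 τ x := by
  have h2 : |b * (x - x₀)| ≤ 2 := by
    rw [abs_mul]
    calc _ ≤ 2 * R * (1 / R) := by gcongr
      _ = 2 := by field_simp
  rw [weightConst, mul_assoc, mul_add, hessianWeight, hl]
  have h3 := exp_mul_gaussianPDFReal_le (θ := 0) hR (by simpa using h0) hx
  have h4 := exp_mul_gaussianPDFReal_le hR h1 hx
  have h5 := gaussianPDFReal_nonneg 0 1 x₀
  have h6 := gaussianPDFReal_nonneg R 1 x₀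
  exact mul_le_mul (sq_sigmoid_neg_two_le h2) (add_le_add h3 h4) (by positivity)
    (mul_nonneg (sigmoid_nonneg _) (sigmoid_nonneg _))

theorem hessianWeight_le_exp_mul (hR : 0 < R) (h0 : |x₀| ≤ R) (h1 : |x₀ - R| ≤ R)
    {x : ℝ} (hx : |x - x₀| ≤ 1 / R) :
    hessianWeight R 0 τ x ≤ exp 1 * (gaussianPDFReal 0 1 x₀ + gaussianPDFReal R 1 x₀) := by
  have h3 := gaussianPDFReal_le_exp_mul (θ := 0) hR (by simpa using h0) hx
  have h4 := gaussianPDFReal_le_exp_mul hR h1 hx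
  have h5 := gaussianPDFReal_nonneg 0 1 x
  have h6 := gaussianPDFReal_nonneg R 1 x
  rw [hessianWeight, mul_add (exp 1)]
  exact (mul_le_of_le_one_left (by positivity)
    ((le_abs_self _).trans (abs_sigmoid_mul_sigmoid_neg_le_one _))).trans (add_le_add h3 h4)

theorem intervalIntegral_affine_sq (a B x₀ r : ℝ) :
    ∫ x in (x₀ - r)..(x₀ + r), (a * (x - x₀) + B) ^ 2 = 2 * a ^ 2 * r ^ 3 / 3 + 2 * B ^ 2 * r := by
  have h (x : ℝ) : HasDerivAt
      (fun x => a ^ 2 * (x - x₀) ^ 3 / 3 + a * B * (x - x₀) ^ 2 + B ^ 2 * (x - x₀))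
      ((a * (x - x₀) + B) ^ 2) x := by
    have h1 := (hasDerivAt_id x).sub_const x₀
    convert! ((((h1.pow 3).const_mul (a ^ 2)).div_const 3).add
      ((h1.pow 2).const_mul (a * B))).add (h1.const_mul (B ^ 2)) using 1
    simp
    ring
  rw [intervalIntegral.integral_eq_sub_of_hasDerivAt (fun x _ => h x)
    (Continuous.intervalIntegrable (by fun_prop) _ _)]
  ring

theorem weightConst_mul_le_integral_hessianWeight (hR : 1 ≤ R) (h0 : |x₀| ≤ R)
    (h1 : |x₀ - R| ≤ R) (hb : |b| ≤ 2 * R) (hl : ∀ x, logit 0 τ x = b * (x - x₀)) {a B : ℝ}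
    (hi : Integrable fun x => hessianWeight R 0 τ x * (a * (x - x₀) + B) ^ 2) :
    weightConst * (gaussianPDFReal 0 1 x₀ + gaussianPDFReal R 1 x₀) *
      (2 * (a / R) ^ 2 / 3 + 2 * B ^ 2) / R ≤
      ∫ x, hessianWeight R 0 τ x * (a * (x - x₀) + B) ^ 2 := by
  have hR0 : 0 < R := by linarith
  have hr : x₀ - 1 / R ≤ x₀ + 1 / R := by
    have : 0 < 1 / R := by positivity
    linarith
  calc _ = ∫ x in Ioc (x₀ - 1 / R) (x₀ + 1 / R),
        weightConst * (gaussianPDFReal 0 1 x₀ + gaussianPDFReal R 1 x₀) *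
          (a * (x - x₀) + B) ^ 2 := by
        rw [← intervalIntegral.integral_of_le hr, intervalIntegral.integral_const_mul,
          intervalIntegral_affine_sq]
        field_simp
    _ ≤ ∫ x in Ioc (x₀ - 1 / R) (x₀ + 1 / R),
        hessianWeight R 0 τ x * (a * (x - x₀) + B) ^ 2 := by
        refine setIntegral_mono_on ?_ hi.integrableOn measurableSet_Ioc fun x hx => ?_
        · exact (Continuous.integrableOn_Icc (by fun_prop)).mono_set Ioc_subset_Icc_self
        · refine mul_le_mul_of_nonneg_right ?_ (sq_nonneg _)
          exact weightConst_mul_le_hessianWeight hR h0 h1 hb hl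
            (abs_le.2 ⟨by linarith [hx.1], by linarith [hx.2]⟩)
    _ ≤ _ := setIntegral_le_integral hi (.of_forall fun x =>
        mul_nonneg (hessianWeight_pos _ _).le (sq_nonneg _))

/-- Both parts of the gradient density decay like `exp (-κ |x - x₀|)`. Half of this rate is spent on
absorbing the affine factor, the other half on integrability. -/
theorem integral_gradient_le {κ : ℝ} (hκ : 0 < κ) (hq₁ : κ ≤ x₀) (hq₂ : x₀ + κ ≤ b)
    (hp₁ : κ ≤ R - x₀) (hp₂ : R - x₀ + κ ≤ b) (a B : ℝ) :
    ∫ x, (sigmoid (b * (x - x₀)) * gaussianPDFReal 0 1 x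
        - sigmoid (-(b * (x - x₀))) * gaussianPDFReal R 1 x) * (a * (x - x₀) + B) ≤
      (gaussianPDFReal 0 1 x₀ + gaussianPDFReal R 1 x₀) * (2 * |a| / κ + |B|) * (4 / κ) := by
  have hw : 0 ≤ gaussianPDFReal 0 1 x₀ + gaussianPDFReal R 1 x₀ :=
    add_nonneg (gaussianPDFReal_nonneg _ _ _) (gaussianPDFReal_nonneg _ _ _)
  have hi := (integrable_exp_neg_mul_abs_sub (half_pos hκ) x₀).const_mul
    ((gaussianPDFReal 0 1 x₀ + gaussianPDFReal R 1 x₀) * (2 * |a| / κ + |B|))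
  have hint : ∫ x, (gaussianPDFReal 0 1 x₀ + gaussianPDFReal R 1 x₀) * (2 * |a| / κ + |B|) *
      exp (-(κ / 2) * |x - x₀|) =
      (gaussianPDFReal 0 1 x₀ + gaussianPDFReal R 1 x₀) * (2 * |a| / κ + |B|) * (4 / κ) := by
    rw [integral_const_mul, integral_exp_neg_mul_abs_sub (half_pos hκ)]
    field_simp
    ring
  rw [← hint]
  refine (le_abs_self _).trans ?_
  rw [← norm_eq_abs]
  refine norm_integral_le_of_norm_le hi (.of_forall fun x => ?_)
  have h1 := sigmoid_mul_gaussianPDFReal_le (θ := 0) (x₀ := x₀) (b := b) (κ := κ)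
    (by linarith) (by linarith) x
  have h2 := sigmoid_neg_mul_gaussianPDFReal_le hp₁ hp₂ x
  have h3 : |sigmoid (b * (x - x₀)) * gaussianPDFReal 0 1 x
        - sigmoid (-(b * (x - x₀))) * gaussianPDFReal R 1 x| ≤
      (gaussianPDFReal 0 1 x₀ + gaussianPDFReal R 1 x₀) * exp (-κ * |x - x₀|) := by
    have h4 := mul_nonneg (sigmoid_nonneg (b * (x - x₀))) (gaussianPDFReal_nonneg 0 1 x)
    have h5 := mul_nonneg (sigmoid_nonneg (-(b * (x - x₀)))) (gaussianPDFReal_nonneg R 1 x)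
    rw [abs_le]
    constructor <;> linarith
  have h4 : |a * (x - x₀) + B| ≤ (2 * |a| / κ + |B|) * exp (κ / 2 * |x - x₀|) := by
    have h5 : |x - x₀| ≤ 2 / κ * exp (κ / 2 * |x - x₀|) := by
      have := add_one_le_exp (κ / 2 * |x - x₀|)
      calc |x - x₀| = 2 / κ * (κ / 2 * |x - x₀|) := by field_simp
        _ ≤ _ := by gcongr; linarith
    have h6 : 1 ≤ exp (κ / 2 * |x - x₀|) := one_le_exp (by positivity)
    calc |a * (x - x₀) + B| ≤ |a| * |x - x₀| + |B| * 1 := by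
          rw [mul_one, ← abs_mul]; exact abs_add_le _ _
      _ ≤ |a| * (2 / κ * exp (κ / 2 * |x - x₀|)) + |B| * exp (κ / 2 * |x - x₀|) := by gcongr
      _ = _ := by ring
  rw [norm_mul, norm_eq_abs, norm_eq_abs]
  calc _ ≤ (gaussianPDFReal 0 1 x₀ + gaussianPDFReal R 1 x₀) * exp (-κ * |x - x₀|) *
        ((2 * |a| / κ + |B|) * exp (κ / 2 * |x - x₀|)) := by gcongr
    _ = (gaussianPDFReal 0 1 x₀ + gaussianPDFReal R 1 x₀) * (2 * |a| / κ + |B|) *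
        (exp (-κ * |x - x₀|) * exp (κ / 2 * |x - x₀|)) := by ring
    _ = _ := by rw [← exp_add]; ring_nf

end Boundary

/-! ### The Newton direction in the annulus. -/

theorem inner_suffStat_eq_affine (d : Param) (x₀ x : ℝ) :
    ⟪d, suffStat x⟫ = d 0 * (x - x₀) + (d 0 * x₀ - d 1) := by
  rw [inner_suffStat]
  ring

theorem norm_param_le (d : Param) : ‖d‖ ≤ |d 0| + |d 1| := by
  rw [EuclideanSpace.norm_eq, Fin.sum_univ_two, norm_eq_abs, norm_eq_abs]
  exact sqrt_le_iff.2 ⟨by positivity, by nlinarith [mul_nonneg (abs_nonneg (d 0)) (abs_nonneg (d 1))]⟩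

theorem add_le_div_of_quadratic_le {k A B : ℝ} (hk : 0 < k) (hA : 0 ≤ A) (hB : 0 ≤ B)
    (h : k * (2 * A ^ 2 / 3 + 2 * B ^ 2) ≤ 40 * (20 * A + B)) : A + B ≤ 2400 / k := by
  rw [le_div_iff₀ hk]
  rcases (add_nonneg hA hB).eq_or_lt with h0 | h0
  · rw [← h0]
    norm_num
  · have h1 : (A + B) ^ 2 ≤ 3 * (2 * A ^ 2 / 3 + 2 * B ^ 2) := by
      linarith [sq_nonneg (A - B), sq_nonneg B]
    have h2 := mul_le_mul_of_nonneg_left h1 hk.le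
    refine le_of_mul_le_mul_right ?_ h0
    linarith

/-- Here `x₀ = c / b`, with `b` within `R / 5` of `R` and `c` within `R / 5` of `R² / 2`. For `R ≥
10` the error in `c` is at most `R² / 50`, which leaves room for all the margins `κ = R / 10`. -/
theorem exists_logit_eq_mul_sub {R : ℝ} (hR : 10 ≤ R) {τ : Param} (hτ : τ ∈ annulus R 0) :
    ∃ b x₀ : ℝ, (∀ x, logit 0 τ x = b * (x - x₀)) ∧ b ≤ 2 * R ∧ R / 10 ≤ x₀ ∧
      x₀ + R / 10 ≤ b ∧ R / 10 ≤ R - x₀ ∧ R - x₀ + R / 10 ≤ b := by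
  have hR0 : 0 < R := by linarith
  have hnorm : ‖τ - natParam R‖ ≤ R / 5 := by
    have := hτ.2
    rw [sub_zero, abs_of_pos hR0] at this
    linarith
  have hb := abs_le.1 ((PiLp.norm_apply_le (τ - natParam R) 0).trans hnorm)
  have hc := abs_le.1 ((PiLp.norm_apply_le (τ - natParam R) 1).trans hnorm)
  simp only [natParam, PiLp.sub_apply, Matrix.cons_val_zero, Matrix.cons_val_one,
    Matrix.cons_val_fin_one] at hb hc
  have hl := logit_zero_eq τ
  generalize τ 0 = b at hb hl
  obtain ⟨c, hc_def⟩ : ∃ c, c = τ 1 - log (√(2 * π)) := ⟨_, rfl⟩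
  have hc1 : R ^ 2 / 2 - R / 5 ≤ c := by rw [hc_def]; linarith [hc.1]
  have hc2 : c ≤ R ^ 2 / 2 + R / 5 := by rw [hc_def]; linarith [hc.2]
  have hb0 : 0 < b := by linarith
  have hup (y : ℝ) (h : c ≤ y * b) : c / b ≤ y := (div_le_iff₀ hb0).2 h
  have hlow (y : ℝ) (h : y * b ≤ c) : y ≤ c / b := (le_div_iff₀ hb0).2 h
  have hx₁ := hlow (R / 10) (by nlinarith)
  have hx₂ := hup (b - R / 10) (by nlinarith)
  have hx₃ := hup (R - R / 10) (by nlinarith)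
  have hx₄ := hlow (R - b + R / 10) (by nlinarith)
  refine ⟨b, c / b, fun x => ?_, by linarith, hx₁, by linarith, by linarith, by linarith⟩
  rw [hl, ← hc_def]
  field_simp

theorem norm_newton_direction_le {R : ℝ} (hR : 10 ≤ R) {τ : Param} (hτ : τ ∈ annulus R 0) :
    ‖(hessian R 0 τ).inverse (gradient (loss R 0) τ)‖ ≤ 4800 / weightConst * R ^ 2 := by
  have hR0 : 0 < R := by linarith
  obtain ⟨b, x₀, hl, hb, hq₁, hq₂, hp₁, hp₂⟩ := exists_logit_eq_mul_sub hR hτ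
  obtain ⟨d, hd⟩ : ∃ d, d = (hessian R 0 τ).inverse (gradient (loss R 0) τ) := ⟨_, rfl⟩
  have heq := congrArg (fun w => ⟪d, w⟫)
    (hessian_apply_inverse (θstar := R) (θq := 0) τ (gradient (loss R 0) τ))
  simp only [← hd] at heq
  rw [← hd]
  rw [inner_hessian_eq_integral, inner_gradient_loss_eq_integral] at heq
  replace heq := mul_left_cancel₀ (by norm_num) heq
  have hi := integrable_hessianWeight_mul (θstar := R) (θq := 0) τ d d
  simp only [inner_suffStat_eq_affine d x₀, hl, ← sq] at heq hi
  have hlow := weightConst_mul_le_integral_hessianWeight (by linarith)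
    (abs_le.2 ⟨by linarith, by linarith⟩) (abs_le.2 ⟨by linarith, by linarith⟩)
    (abs_le.2 ⟨by linarith, by linarith⟩) hl hi
  have hup := integral_gradient_le (by positivity) hq₁ hq₂ hp₁ hp₂ (d 0) (d 0 * x₀ - d 1)
  rw [heq] at hlow
  -- The energy identity `⟪d, H d⟫ = ⟪d, ∇L⟫` links the quadratic lower bound to the linear upper
  -- bound; the common, exponentially small factor `w` is about to cancel.
  have h1 := hlow.trans hup
  clear hlow hup heq hi
  have hw : 0 < gaussianPDFReal 0 1 x₀ + gaussianPDFReal R 1 x₀ :=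
    add_pos (gaussianPDFReal_pos _ _ _ one_ne_zero) (gaussianPDFReal_pos _ _ _ one_ne_zero)
  generalize gaussianPDFReal 0 1 x₀ + gaussianPDFReal R 1 x₀ = w at h1 hw
  have hk := weightConst_pos
  obtain ⟨B, hB⟩ : ∃ B, B = d 0 * x₀ - d 1 := ⟨_, rfl⟩
  -- The slope is measured at the scale `1 / R` of the boundary layer, so that `A` and `|B|` become
  -- comparable.
  obtain ⟨A, hA⟩ : ∃ A, A = |d 0| / R := ⟨_, rfl⟩
  have hA0 : 0 ≤ A := by rw [hA]; positivity
  have hB0 : 0 ≤ |B| := abs_nonneg B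
  have hAR : |d 0| = A * R := by rw [hA]; field_simp
  have hS : A + |B| ≤ 2400 / weightConst := by
    refine add_le_div_of_quadratic_le hk hA0 hB0 ?_
    have h2 : (d 0 / R) ^ 2 = A ^ 2 := by rw [hA, div_pow, div_pow, sq_abs]
    rw [← hB, h2, hAR, ← sq_abs B] at h1
    have h3 : w / R * (weightConst * (2 * A ^ 2 / 3 + 2 * |B| ^ 2)) ≤
        w / R * (40 * (20 * A + |B|)) := by
      refine (le_of_eq ?_).trans (h1.trans (le_of_eq ?_)) <;> field_simp
      ring
    exact le_of_mul_le_mul_left h3 (by positivity)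
  have hd1 : |d 1| ≤ A * R * R + |B| := by
    have h1 : d 1 = d 0 * x₀ - B := by rw [hB]; ring
    rw [h1]
    refine (abs_sub _ _).trans ?_
    rw [abs_mul, hAR]
    gcongr
    exact abs_le.2 ⟨by linarith, by linarith⟩
  calc ‖d‖ ≤ |d 0| + |d 1| := norm_param_le d
    _ ≤ (A + |B|) * (2 * R ^ 2) := by
        rw [hAR]
        have h1 : A * R ≤ A * R ^ 2 := by gcongr; nlinarith
        have h2 : |B| ≤ |B| * R ^ 2 := le_mul_of_one_le_right hB0 (by nlinarith)
        linarith
    _ ≤ 2400 / weightConst * (2 * R ^ 2) := by gcongr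
    _ = _ := by ring

/-! ### Newton iteration along the axis. -/

section Axis

theorem inner_axis_hessian_pos (R : ℝ) (τ : Param) :
    0 < ⟪axis R, hessian R 0 τ (axis R)⟫ := by
  refine inner_hessian_self_pos _ fun h => ?_
  have := congrArg (fun d : Param => d 0) h
  simp [axis] at this

theorem newtonStep_axis (R η b : ℝ) :
    newtonStep R 0 η (natParam 0 + b • axis R) =
      natParam 0 + (b + η * (-⟪axis R, gradient (loss R 0) (natParam 0 + b • axis R)⟫ /
        ⟪axis R, hessian R 0 (natParam 0 + b • axis R) (axis R)⟫)) • axis R := by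
  have hh := inner_axis_hessian_pos R (natParam 0 + b • axis R)
  have hg := gradient_loss_axis R b
  have hd : hessian R 0 (natParam 0 + b • axis R)
      ((⟪axis R, gradient (loss R 0) (natParam 0 + b • axis R)⟫ /
        ⟪axis R, hessian R 0 (natParam 0 + b • axis R) (axis R)⟫) • axis R) =
      gradient (loss R 0) (natParam 0 + b • axis R) := by
    rw [map_smul, hg, hessian_axis, smul_smul, ← hg, ← hessian_axis, div_mul_cancel₀ _ hh.ne', ← hg]
  rw [newtonStep, inverse_hessian_eq hd, smul_smul, add_sub_assoc, ← sub_smul]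
  congr 2
  ring

variable {R b : ℝ}

theorem sigmoid_mul_sub_axis (R b x : ℝ) :
    sigmoid (b * (x - R / 2)) * gaussianPDFReal 0 1 x
      - sigmoid (-(b * (x - R / 2))) * gaussianPDFReal R 1 x =
    sigmoid (-(b * (x - R / 2))) * gaussianPDFReal 0 1 x *
      (exp (b * (x - R / 2)) - exp (R * (x - R / 2))) := by
  have h1 := sigmoid_mul_rexp_neg (-(b * (x - R / 2)))
  rw [neg_neg] at h1
  have h2 : gaussianPDFReal R 1 x = gaussianPDFReal 0 1 x * exp (R * (x - R / 2)) := by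
    rw [gaussianPDFReal_eq_mul, gaussianPDFReal_zero_eq_mul R,
      mul_assoc _ (exp (-(R * (x - R / 2) / 2))), ← exp_add]
    ring_nf
  rw [← h1, h2]
  ring

/-- The density is a nonnegative multiple of `exp (b y) - exp (R y)` with `y = x - R / 2`, whose
sign is opposite to that of `y`. Thus `b` never decreases before reaching `R`. -/
theorem gradient_integrand_nonpos (hb : b ≤ R) (x : ℝ) :
    (sigmoid (b * (x - R / 2)) * gaussianPDFReal 0 1 x
      - sigmoid (-(b * (x - R / 2))) * gaussianPDFReal R 1 x) * (x - R / 2) ≤ 0 := by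
  rw [sigmoid_mul_sub_axis, mul_assoc]
  refine mul_nonpos_of_nonneg_of_nonpos
    (mul_nonneg (sigmoid_nonneg _) (gaussianPDFReal_nonneg _ _ _)) ?_
  rcases le_total 0 (x - R / 2) with h | h
  · exact mul_nonpos_of_nonpos_of_nonneg
      (sub_nonpos.2 (exp_le_exp.2 (mul_le_mul_of_nonneg_right hb h))) h
  · exact mul_nonpos_of_nonneg_of_nonpos
      (sub_nonneg.2 (exp_le_exp.2 (mul_le_mul_of_nonpos_right hb h))) h

theorem inner_axis_gradient_nonpos (hb : b ≤ R) :
    ⟪axis R, gradient (loss R 0) (natParam 0 + b • axis R)⟫ ≤ 0 := by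
  rw [inner_gradient_loss_eq_integral]
  simp only [logit_add_smul_axis, inner_axis_suffStat]
  exact mul_nonpos_of_nonneg_of_nonpos (by norm_num)
    (integral_nonpos fun x => gradient_integrand_nonpos hb x)

theorem half_le_sigmoid {u : ℝ} (hu : 0 ≤ u) : 1 / 2 ≤ sigmoid u := by
  have := sigmoid_le hu
  rw [sigmoid_zero] at this
  linarith

/-- On each side of `R / 2` the term with the favourable sign is dropped; in the other one the
missing sigmoid factor is at least `1 / 2`, so inserting it costs a factor `2`. -/
theorem neg_gradient_integrand_le (hb : 0 ≤ b) (x : ℝ) :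
    -((sigmoid (b * (x - R / 2)) * gaussianPDFReal 0 1 x
      - sigmoid (-(b * (x - R / 2))) * gaussianPDFReal R 1 x) * (x - R / 2)) ≤
    2 * (hessianWeight R 0 (natParam 0 + b • axis R) x * |x - R / 2|) := by
  have hq := gaussianPDFReal_nonneg 0 1 x
  have hp := gaussianPDFReal_nonneg R 1 x
  rw [hessianWeight, logit_add_smul_axis]
  have hσ := sigmoid_nonneg (b * (x - R / 2))
  have hσ' := sigmoid_nonneg (-(b * (x - R / 2)))
  rcases le_total 0 (x - R / 2) with h | h
  · have h1 := half_le_sigmoid (mul_nonneg hb h)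
    rw [abs_of_nonneg h]
    generalize sigmoid (b * (x - R / 2)) = s at *
    generalize sigmoid (-(b * (x - R / 2))) = s' at *
    have h2 : s' * gaussianPDFReal R 1 x ≤ 2 * (s * s') * gaussianPDFReal R 1 x :=
      mul_le_mul_of_nonneg_right (by nlinarith) hp
    have h3 := mul_nonneg hσ hq
    have h4 := mul_nonneg (mul_nonneg hσ hσ') hq
    calc _ = (s' * gaussianPDFReal R 1 x - s * gaussianPDFReal 0 1 x) * (x - R / 2) := by ring
      _ ≤ (2 * (s * s' * (gaussianPDFReal 0 1 x + gaussianPDFReal R 1 x))) * (x - R / 2) :=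
        mul_le_mul_of_nonneg_right (by linarith) h
      _ = _ := by ring
  · have h1 := half_le_sigmoid (u := -(b * (x - R / 2)))
      (neg_nonneg.2 (mul_nonpos_of_nonneg_of_nonpos hb h))
    rw [abs_of_nonpos h]
    generalize sigmoid (b * (x - R / 2)) = s at *
    generalize sigmoid (-(b * (x - R / 2))) = s' at *
    have h2 : s * gaussianPDFReal 0 1 x ≤ 2 * (s * s') * gaussianPDFReal 0 1 x :=
      mul_le_mul_of_nonneg_right (by nlinarith) hq
    have h3 := mul_nonneg hσ' hp
    have h4 := mul_nonneg (mul_nonneg hσ hσ') hp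
    calc _ = (s * gaussianPDFReal 0 1 x - s' * gaussianPDFReal R 1 x) * -(x - R / 2) := by ring
      _ ≤ (2 * (s * s' * (gaussianPDFReal 0 1 x + gaussianPDFReal R 1 x))) * -(x - R / 2) :=
        mul_le_mul_of_nonneg_right (by linarith) (neg_nonneg.2 h)
      _ = _ := by ring

/-- Where `|y| ≥ 1 / R` one has `|y| ≤ R y²`; the remaining interval has length `2 / R` and
contributes only `O((p_* + q)(R / 2) / R²)`. -/
theorem hessianWeight_mul_abs_le (hR : 0 < R) (τ : Param) (x : ℝ) :
    hessianWeight R 0 τ x * |x - R / 2| ≤ R * (hessianWeight R 0 τ x * (x - R / 2) ^ 2) +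
      (Icc (R / 2 - 1 / R) (R / 2 + 1 / R)).indicator (fun _ =>
        exp 1 * (gaussianPDFReal 0 1 (R / 2) + gaussianPDFReal R 1 (R / 2)) / R) x := by
  have hW := (hessianWeight_pos (θstar := R) (θq := 0) τ x).le
  by_cases hx : x ∈ Icc (R / 2 - 1 / R) (R / 2 + 1 / R)
  · have hx' : |x - R / 2| ≤ 1 / R := abs_le.2 ⟨by linarith [hx.1], by linarith [hx.2]⟩
    rw [indicator_of_mem hx]
    have h1 := hessianWeight_le_exp_mul (τ := τ) hR (x₀ := R / 2)
      (abs_le.2 ⟨by linarith, by linarith⟩) (abs_le.2 ⟨by linarith, by linarith⟩) hx'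
    refine le_add_of_nonneg_of_le (by positivity) ?_
    rw [← mul_one_div (exp 1 * _)]
    exact mul_le_mul h1 hx' (abs_nonneg _) (hW.trans h1)
  · have hx' : 1 / R ≤ |x - R / 2| := by
      by_contra! h
      exact hx ⟨by linarith [(abs_lt.1 h).1], by linarith [(abs_lt.1 h).2]⟩
    rw [indicator_of_notMem hx, add_zero, mul_left_comm]
    refine mul_le_mul_of_nonneg_left ?_ hW
    rw [← sq_abs, sq, ← mul_assoc]
    refine le_mul_of_one_le_left (abs_nonneg _) ?_
    rwa [div_le_iff₀' hR] at hx'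

/-- Bound, up to a factor `R`, for the Newton direction along the segment from `τ_q` to `τ_*`. -/
noncomputable def axisConst : ℝ := 4 + 12 * exp 1 / weightConst

theorem axisConst_pos : 0 < axisConst := by
  have := weightConst_pos
  unfold axisConst
  positivity

/-- The gradient is compared with the Hessian form directly, because the exponential decay used in
the annulus fails for small `b`. The inner interval's contribution is absorbed by the lower bound
for the Hessian form on that same interval (`hsmall`). -/
theorem neg_inner_axis_gradient_le (hR : 1 ≤ R) (hb : 0 ≤ b) (hbR : b ≤ R) :
    -⟪axis R, gradient (loss R 0) (natParam 0 + b • axis R)⟫ ≤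
      axisConst * R * ⟪axis R, hessian R 0 (natParam 0 + b • axis R) (axis R)⟫ := by
  have hR0 : 0 < R := by linarith
  have hk := weightConst_pos
  have hi := integrable_hessianWeight_mul (θstar := R) (θq := 0) (natParam 0 + b • axis R)
    (axis R) (axis R)
  rw [inner_gradient_loss_eq_integral, inner_hessian_eq_integral]
  simp only [inner_axis_suffStat, ← sq] at hi ⊢
  have hlow := weightConst_mul_le_integral_hessianWeight (a := 1) (B := 0) hR (x₀ := R / 2)
    (abs_le.2 ⟨by linarith, by linarith⟩) (abs_le.2 ⟨by linarith, by linarith⟩)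
    (abs_le.2 ⟨by linarith, by linarith⟩) (logit_add_smul_axis R b) (by simpa using hi)
  simp only [one_mul, add_zero] at hlow
  have hw : 0 < gaussianPDFReal 0 1 (R / 2) + gaussianPDFReal R 1 (R / 2) :=
    add_pos (gaussianPDFReal_pos _ _ _ one_ne_zero) (gaussianPDFReal_pos _ _ _ one_ne_zero)
  have hind : Integrable ((Icc (R / 2 - 1 / R) (R / 2 + 1 / R)).indicator (fun _ =>
      exp 1 * (gaussianPDFReal 0 1 (R / 2) + gaussianPDFReal R 1 (R / 2)) / R)) :=
    (integrable_indicator_iff measurableSet_Icc).2 (integrableOn_const (by simp))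
  have hup : -∫ x, (sigmoid (logit 0 (natParam 0 + b • axis R) x) * gaussianPDFReal 0 1 x
      - sigmoid (-logit 0 (natParam 0 + b • axis R) x) * gaussianPDFReal R 1 x) * (x - R / 2) ≤
      2 * (R * ∫ x, hessianWeight R 0 (natParam 0 + b • axis R) x * (x - R / 2) ^ 2) +
      2 * (2 / R * (exp 1 * (gaussianPDFReal 0 1 (R / 2) + gaussianPDFReal R 1 (R / 2)) / R)) := by
    have h1 : ∫ x, (Icc (R / 2 - 1 / R) (R / 2 + 1 / R)).indicator (fun _ =>
        exp 1 * (gaussianPDFReal 0 1 (R / 2) + gaussianPDFReal R 1 (R / 2)) / R) x =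
        2 / R * (exp 1 * (gaussianPDFReal 0 1 (R / 2) + gaussianPDFReal R 1 (R / 2)) / R) := by
      have hr : 0 ≤ R / 2 + 1 / R - (R / 2 - 1 / R) := by
        have : 0 < 1 / R := by positivity
        linarith
      rw [integral_indicator_const _ measurableSet_Icc, Real.volume_real_Icc, max_eq_left hr,
        smul_eq_mul]
      ring
    have h2 := (hi.const_mul R).add hind
    rw [← h1, ← integral_const_mul, ← mul_add, ← integral_add (hi.const_mul R) hind,
      ← integral_const_mul, ← integral_neg]
    refine integral_mono_of_nonneg ?_ (h2.const_mul 2) (.of_forall fun x => ?_)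
    · refine .of_forall fun x => ?_
      simp only [logit_add_smul_axis, Pi.zero_apply]
      exact neg_nonneg.2 (gradient_integrand_nonpos hbR x)
    · simp only [logit_add_smul_axis]
      exact (neg_gradient_integrand_le hb x).trans
        (mul_le_mul_of_nonneg_left (hessianWeight_mul_abs_le hR0 _ x) (by norm_num))
  have hsmall : (gaussianPDFReal 0 1 (R / 2) + gaussianPDFReal R 1 (R / 2)) / R ^ 2 ≤
      3 / (2 * weightConst) * R *
        ∫ x, hessianWeight R 0 (natParam 0 + b • axis R) x * (x - R / 2) ^ 2 := by
    calc _ = 3 / (2 * weightConst) * R * (weightConst * (gaussianPDFReal 0 1 (R / 2) +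
          gaussianPDFReal R 1 (R / 2)) * (2 * (1 / R) ^ 2 / 3 + 2 * 0 ^ 2) / R) := by
          field_simp
          ring
      _ ≤ _ := by gcongr
  rw [← mul_neg]
  calc _ ≤ 1 / 2 * (2 * (R * ∫ x, hessianWeight R 0 (natParam 0 + b • axis R) x *
          (x - R / 2) ^ 2) + 4 * exp 1 * ((gaussianPDFReal 0 1 (R / 2) +
          gaussianPDFReal R 1 (R / 2)) / R ^ 2)) := by
        refine mul_le_mul_of_nonneg_left (hup.trans (le_of_eq ?_)) (by norm_num)
        field_simp
        ring
    _ ≤ 1 / 2 * (2 * (R * ∫ x, hessianWeight R 0 (natParam 0 + b • axis R) x *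
          (x - R / 2) ^ 2) + 4 * exp 1 * (3 / (2 * weightConst) * R *
          ∫ x, hessianWeight R 0 (natParam 0 + b • axis R) x * (x - R / 2) ^ 2)) := by gcongr
    _ ≤ _ := by
        have hI : 0 ≤ ∫ x, hessianWeight R 0 (natParam 0 + b • axis R) x * (x - R / 2) ^ 2 :=
          integral_nonneg fun x => mul_nonneg (hessianWeight_pos _ _).le (sq_nonneg _)
        generalize (∫ x, hessianWeight R 0 (natParam 0 + b • axis R) x * (x - R / 2) ^ 2) = I at hI
        have h1 : axisConst = 4 + 12 * exp 1 / weightConst := rfl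
        have h2 : 0 ≤ exp 1 / weightConst * R * I := by positivity
        have h3 : 0 ≤ R * I := by positivity
        have h4 : 12 * exp 1 / weightConst * R * (1 / 2 * I) =
          6 * (exp 1 / weightConst * R * I) := by ring
        have h5 : 4 * exp 1 * (3 / (2 * weightConst) * R * I) =
          6 * (exp 1 / weightConst * R * I) := by field_simp; ring
        rw [h1, add_mul, add_mul, h4, h5]
        linarith

theorem newtonIter_eq_axis (hR : 1 ≤ R) {η : ℝ} (hη : 0 < η) (t : ℕ)
    (ht : t * (η * (axisConst * R)) ≤ R) :
    ∃ b, 0 ≤ b ∧ b ≤ t * (η * (axisConst * R)) ∧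
      newtonIter R 0 η t = natParam 0 + b • axis R := by
  induction t with
  | zero => exact ⟨0, le_rfl, by simp, by simp [newtonIter]⟩
  | succ t ih =>
    have hδ : 0 < η * (axisConst * R) := by
      have := axisConst_pos
      positivity
    push_cast at ht ⊢
    obtain ⟨b, hb0, hb, he⟩ := ih (by linarith)
    refine ⟨_, ?_, ?_, by
      rw [newtonIter, Function.iterate_succ_apply', ← newtonIter, he, newtonStep_axis]⟩
    · have h1 := inner_axis_gradient_nonpos (R := R) (b := b) (by linarith)
      have h2 := inner_axis_hessian_pos R (natParam 0 + b • axis R)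
      have h3 := div_nonneg (neg_nonneg.2 h1) h2.le
      positivity
    · have h1 := neg_inner_axis_gradient_le hR hb0 (by linarith)
      have h2 := inner_axis_hessian_pos R (natParam 0 + b • axis R)
      have h3 := (div_le_iff₀ h2).2 h1
      have h4 := mul_le_mul_of_nonneg_left h3 hη.le
      linarith

/-- As long as `b < R / 2`, the distance to the optimum is `(R - b) ‖axis R‖ ≥ R² / 4`, which
exceeds `0.1 R`. -/
theorem half_le_mul_of_newtonIter_near (hR : 1 ≤ R) {η : ℝ} (hη : 0 < η) (t : ℕ)
    (ht : ‖newtonIter R 0 η t - natParam R‖ ≤ 0.1 * R) :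
    R / 2 ≤ t * (η * (axisConst * R)) := by
  by_contra! h
  obtain ⟨b, hb0, hb, he⟩ := newtonIter_eq_axis hR hη t (by linarith)
  rw [he, natParam_eq_add_smul_axis R, add_sub_add_left_eq_sub, ← sub_smul, norm_smul,
    norm_eq_abs, abs_of_neg (by linarith)] at ht
  have h1 := half_le_norm_axis R
  have h2 : R / 2 ≤ -(b - R) := by linarith
  have h3 := mul_le_mul h2 h1 (by linarith) (by linarith)
  nlinarith

end Axis

end GaussianNCE

open GaussianNCE

theorem mainTheorem2 :
    ∀ C : ℝ, 0 < C → ∃ c K R₀ : ℝ, 0 < c ∧ 0 < K ∧ 0 < R₀ ∧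
      ∀ R : ℝ, R₀ ≤ R →
        -- the Newton step is well defined at every point
        (∀ τ : GaussianNCE.Param, (GaussianNCE.hessian R 0 τ).IsInvertible) ∧
        ∀ (Θ : Set ℝ), Bornology.IsBounded Θ → 0 ∈ Θ → R ∈ Θ →
        ∀ η : ℝ, 0 < η →
          η ≤ C * (GaussianNCE.lambdaRho R 0 Θ / GaussianNCE.lambdaM R 0 Θ) →
          -- a step from inside the annulus decreases the distance to the optimum very little
          (∀ τ ∈ GaussianNCE.annulus R 0,
            ‖τ - GaussianNCE.natParam R‖
                - ‖GaussianNCE.newtonStep R 0 η τ - GaussianNCE.natParam R‖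
              ≤ K * (Real.exp (-R ^ 2 / 8) / R ^ 3)) ∧
          -- entering the inner disc takes exponentially many steps
          (∀ t : ℕ,
            ‖GaussianNCE.newtonIter R 0 η t - GaussianNCE.natParam R‖ ≤ 0.1 * R →
              c * (R ^ 3 * Real.exp (R ^ 2 / 8)) ≤ (t : ℝ)) := by
  intro C hC
  have hk := weightConst_pos
  have ha := axisConst_pos
  -- The factor `64 C` comes from `stepSize_le`; `128` is its double, since `b` must travel `R / 2`.
  refine ⟨1 / (128 * C * axisConst), 64 * C * (4800 / weightConst), 10, by positivity,
    by positivity, by norm_num, fun R hR => ⟨fun τ => isInvertible_hessian τ, ?_⟩⟩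
  intro Θ _ h0 hRΘ η hη hηC
  have hR0 : 0 < R := by linarith
  have hstep := stepSize_le hC hR0 h0 hRΘ hηC
  refine ⟨fun τ hτ => ?_, fun t ht => ?_⟩
  · have h1 := norm_newton_direction_le hR hτ
    have h2 : ‖τ - natParam R‖ - ‖newtonStep R 0 η τ - natParam R‖ ≤
        η * ‖(hessian R 0 τ).inverse (gradient (loss R 0) τ)‖ := by
      refine (norm_sub_norm_le _ _).trans (le_of_eq ?_)
      rw [newtonStep, sub_sub_sub_cancel_right, sub_sub_cancel, norm_smul, norm_of_nonneg hη.le]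
    calc _ ≤ η * ‖(hessian R 0 τ).inverse (gradient (loss R 0) τ)‖ := h2
      _ ≤ 64 * C * exp (-R ^ 2 / 8) / R ^ 5 * (4800 / weightConst * R ^ 2) := by gcongr
      _ = _ := by field_simp
  · have h1 := half_le_mul_of_newtonIter_near (by linarith) hη t ht
    have hE : exp (-R ^ 2 / 8) * exp (R ^ 2 / 8) = 1 := by
      rw [← exp_add, neg_div, neg_add_cancel, exp_zero]
    have hE0 := exp_pos (R ^ 2 / 8)
    have h2 : R / 2 ≤ t * (64 * C * exp (-R ^ 2 / 8) / R ^ 5 * (axisConst * R)) :=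
      h1.trans (by gcongr)
    -- The argument on the axis yields the power `R⁵`; it is weakened to `R³` at the end.
    have h3 : R ^ 5 * exp (R ^ 2 / 8) ≤ t * (128 * C * axisConst) := by
      have h4 := mul_le_mul_of_nonneg_left h2
        (show 0 ≤ 2 * R ^ 4 * exp (R ^ 2 / 8) by positivity)
      calc R ^ 5 * exp (R ^ 2 / 8) = 2 * R ^ 4 * exp (R ^ 2 / 8) * (R / 2) := by ring
        _ ≤ _ := h4
        _ = t * (128 * C * axisConst) * (exp (-R ^ 2 / 8) * exp (R ^ 2 / 8)) := by
          field_simp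
          ring
        _ = _ := by rw [hE, mul_one]
    rw [one_div_mul_eq_div, div_le_iff₀ (by positivity)]
    refine le_trans ?_ h3
    gcongr
    · linarith
    · norm_num
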